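/- Let $L,P_1,P_2>0$, $D=(0,L)\times\mathbb R^2$, $\overline D=[0,L]\times\mathbb R^2$ with coordinates $(x,y,z)$, and $\overline{\mathcal P}=[0,L]\times[0,P_1]\times[0,P_2]$. Let $\bar f,\bar g\in C^\infty(\overline D)$ have constant gradients such that the first component of $\bar v=\nabla\bar f\times\nabla\bar g$ does not vanish. Put $$R=\begin{pmatrix}\partial_2\bar f&\partial_3\bar f\\ \partial_2\bar g&\partial_3\bar g\end{pmatrix},$$ and let $\overline{\mathcal Q}\subset\mathbb R^2$ be the closed parallelogram spanned by $RP_1e_1$ and $RP_2e_2$. A pair $(f,g)$ of real functions on $\overline D$ is called admissible if $f,g\in C^3(\overline D)$ and $\nabla f,\nabla g$ are $P_1$-periodic in $y$ and $P_2$-periodic in $z$. Then there are $\delta>0$ and $\eta>0$, depending only on $L,P_1,P_2,\bar f,\bar g$, with the following property. Let $c_1,c_2\in\mathbb R$, let $H_0\in C^2(\mathbb R^2)$ be periodic with respect to the lattice generated by $RP_1e_1$ and $RP_2e_2$, and let $H(f,g)=c_1f+c_2g+H_0(f,g)$. Assume $\sup_{\overline{\mathcal Q}}\|H_0''\|<\eta$.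 Let $(f,g)$ and $(\widetilde f,\widetilde g)$ be admissible pairs with $$(f,g)=(\widetilde f,\widetilde g)\quad\text{on }\{0,L\}\times\mathbb R^2,$$ both of which solve the Euler–Lagrange system $$-\operatorname{div}\big(\nabla g\times(\nabla f\times\nabla g)\big)+\partial_fH(f,g)=0,\qquad -\operatorname{div}\big((\nabla f\times\nabla g)\times\nabla f\big)+\partial_gH(f,g)=0\quad\text{on }D$$ (for $(\widetilde f,\widetilde g)$: with $f,g$ replaced by $\widetilde f,\widetilde g$). If $(\nabla f,\nabla g)$ and $(\nabla\widetilde f,\nabla\widetilde g)$ both lie in the (open, convex) ball of radius $\delta$ centred at $(\nabla\bar f,\nabla\bar g)$ in $C^2(\overline{\mathcal P})$, then $(f,g)=(\widetilde f,\widetilde g)$ on $\overline D=[0,L]\times\mathbb R^2$. -/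

import Mathlib

open Set Matrix
open scoped ENNReal ContDiff

/-- The closed layer `[0, L] × ℝ²`, the closure of `D = (0, L) × ℝ²`. Coordinates `0, 1, 2` of
`Fin 3 → ℝ` are `x, y, z`. -/
def closedLayer (L : ℝ) : Set (Fin 3 → ℝ) := {p | p 0 ∈ Icc 0 L}

/-- The open layer `D = (0, L) × ℝ²`. -/
def openLayer (L : ℝ) : Set (Fin 3 → ℝ) := {p | p 0 ∈ Ioo 0 L}

/-- The closed cell `[0, L] × [0, P₁] × [0, P₂]`. -/
def closedCell (L P₁ P₂ : ℝ) : Set (Fin 3 → ℝ) :=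
  {p | p 0 ∈ Icc 0 L ∧ p 1 ∈ Icc 0 P₁ ∧ p 2 ∈ Icc 0 P₂}

/-- The gradient of a function on the closed layer (one-sided in `x` at the two boundary planes). -/
noncomputable def layerGrad (L : ℝ) (f : (Fin 3 → ℝ) → ℝ) (p : Fin 3 → ℝ) : Fin 3 → ℝ :=
  fun i => fderivWithin ℝ f (closedLayer L) p (Pi.single i 1)

/-- The divergence of a vector field on the closed layer. -/
noncomputable def layerDiv (L : ℝ) (u : (Fin 3 → ℝ) → (Fin 3 → ℝ)) (p : Fin 3 → ℝ) : ℝ :=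
  ∑ i, fderivWithin ℝ (fun q => u q i) (closedLayer L) p (Pi.single i 1)

/-- `u` is `P₁`-periodic in `y` and `P₂`-periodic in `z` on the closed layer. -/
def LayerPeriodic {E : Type*} (L P₁ P₂ : ℝ) (u : (Fin 3 → ℝ) → E) : Prop :=
  ∀ p ∈ closedLayer L,
    u (p + Pi.single 1 P₁) = u p ∧ u (p + Pi.single 2 P₂) = u p

/-- An admissible pair: both functions are of class `C³` up to the boundary of the layer and their
gradients are `(P₁, P₂)`-periodic in `(y, z)`. -/
structure AdmissiblePair (L P₁ P₂ : ℝ) (f g : (Fin 3 → ℝ) → ℝ) : Prop where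
  contDiffOn_fst : ContDiffOn ℝ 3 f (closedLayer L)
  contDiffOn_snd : ContDiffOn ℝ 3 g (closedLayer L)
  periodic_fst : LayerPeriodic L P₁ P₂ (layerGrad L f)
  periodic_snd : LayerPeriodic L P₁ P₂ (layerGrad L g)

/-- The velocity field `v = ∇f × ∇g`. -/
noncomputable def layerVelocity (L : ℝ) (f g : (Fin 3 → ℝ) → ℝ) (p : Fin 3 → ℝ) : Fin 3 → ℝ :=
  layerGrad L f p ⨯₃ layerGrad L g p

/-- The Euler–Lagrange system on `D`:
`-div(∇g × (∇f × ∇g)) + ∂_f H(f, g) = 0` and `-div((∇f × ∇g) × ∇f) + ∂_g H(f, g) = 0`. -/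
def SolvesEulerLagrange (L : ℝ) (H : (Fin 2 → ℝ) → ℝ) (f g : (Fin 3 → ℝ) → ℝ) : Prop :=
  ∀ p ∈ openLayer L,
    - layerDiv L (fun q => layerGrad L g q ⨯₃ layerVelocity L f g q) p
        + fderiv ℝ H ![f p, g p] (Pi.single 0 1) = 0 ∧
    - layerDiv L (fun q => layerVelocity L f g q ⨯₃ layerGrad L f q) p
        + fderiv ℝ H ![f p, g p] (Pi.single 1 1) = 0

/-- The `C²` norm over the closed cell: the sum over `k = 0, 1, 2` of the suprema of the norms of
the `k`-th derivatives. It takes values in `[0, ∞]`, so no boundedness convention is involved. -/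
noncomputable def cellC2Norm {E : Type*} [NormedAddCommGroup E] [NormedSpace ℝ E]
    (L P₁ P₂ : ℝ) (u : (Fin 3 → ℝ) → E) : ℝ≥0∞ :=
  ∑ k ∈ Finset.range 3, ⨆ p ∈ closedCell L P₁ P₂,
    ‖iteratedFDerivWithin ℝ k u (closedLayer L) p‖ₑ

/-- The `C²` distance over the closed cell between `(∇f, ∇g)` and `(∇f', ∇g')`. -/
noncomputable def gradC2Dist (L P₁ P₂ : ℝ) (f g f' g' : (Fin 3 → ℝ) → ℝ) : ℝ≥0∞ :=
  cellC2Norm L P₁ P₂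
    (fun p => (layerGrad L f p - layerGrad L f' p, layerGrad L g p - layerGrad L g' p))

/-- The Jacobian matrix with respect to `(y, z)` of a pair of functions with constant gradients
`a` and `b`. -/
def crossSectionMatrix (a b : Fin 3 → ℝ) : Matrix (Fin 2) (Fin 2) ℝ :=
  !![a 1, a 2; b 1, b 2]

/-- The closed parallelogram in `ℝ²` spanned by `w₁` and `w₂`. -/
def closedParallelogram (w₁ w₂ : Fin 2 → ℝ) : Set (Fin 2 → ℝ) :=
  {q | ∃ s ∈ Icc (0 : ℝ) 1, ∃ t ∈ Icc (0 : ℝ) 1, q = s • w₁ + t • w₂}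

/-- The supremum over `S` of the norm of the second derivative of `H₀`. -/
noncomputable def supNormSecondDeriv (S : Set (Fin 2 → ℝ)) (H₀ : (Fin 2 → ℝ) → ℝ) : ℝ≥0∞ :=
  ⨆ q ∈ S, ‖iteratedFDeriv ℝ 2 H₀ q‖ₑ

/-!
Let `F = f - f'` and `G = g - g'`. They vanish on the two boundary planes, and therefore, since
their gradients are periodic, they are periodic themselves
(`add_single_eq_of_layerGrad_periodic`). Uniqueness comes from the convexity of the action
`∫ ½ |∇f × ∇g|² + H(f, g)` near the constant gradients, made quantitative by a single vector
field `Z` (`coercivityField`). It is periodic and zero on the boundary planes, so that its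
divergence has integral zero over the cell (`integral_layerDiv_eq_zero`), while
`div Z ≥ const · (F² + G²)` pointwise; hence `F = G = 0` (`eq_zero_of_le_layerDiv`).

Let `A`, `B` be the mean gradients `½ (∇f + ∇f')`, `½ (∇g + ∇g')`, and put `v = A × B`,
`j = curl v`, `W = ∇F × B + A × ∇G`, `X = ∇F × ∇G`.

* The difference of the Euler–Lagrange equations tested with `(F, G)` gives, up to a divergence,
  `|W|² + 2 v · X + ½ |X|²` plus a term bounded by `sup ‖H₀''‖ (F² + G²)`. As the expansion is
  taken about the midpoint, this is an exact identity (`flux_difference_identity`) and no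
  integration along the segment between the two pairs is needed.
* The square `|W|²` controls `v · ∇F`, `v · ∇G` and the combination
  `S = (B × v) · ∇F + (v × A) · ∇G` of transverse derivatives (`linearized_velocity_controls`),
  but not the transverse derivatives separately. Up to a divergence `v · X` is `F ∇G · j`.
  Expanding the small field `j` in the frame `v`, `B × v`, `v × A` (`velocity_frame_expansion`)
  and using `S` to exchange transverse derivatives of `G` for those of `F`, one can write
  every transverse derivative that remains as a derivative of `F²`, `F G` or `G²`, and integrate it
  by parts. What is left is quadratic in `F`, `G`, `v · ∇G` and `S` with small coefficients
  (`layerDiv_coercivityField`).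
  One derivative falls on the coefficients of `j`, which is why the gradients have to be close in
  `C²`.
* Since `div v = 0`, the divergence of `x (F² + G²) v` is
  `v₀ (F² + G²) + 2 x (F v · ∇F + G v · ∇G)`. The first component `v₀` is bounded
  away from zero, so this is a Poincaré inequality along the streamlines and gives the lower
  bound by `F² + G²` (`coercivity_estimate`).

All coefficients are smooth functions of the first-order jet of `(A, B)` near the constant jet,
which yields their smallness and that of their derivatives by continuity (`exists_jet_control`).
-/

/-! ### Vector calculus on the closed layer -/

lemma mem_closedLayer {L : ℝ} {p : Fin 3 → ℝ} : p ∈ closedLayer L ↔ 0 ≤ p 0 ∧ p 0 ≤ L := Iff.rfl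

lemma convex_closedLayer (L : ℝ) : Convex ℝ (closedLayer L) :=
  (convex_Icc 0 L).is_linear_preimage (IsLinearMap.mk (fun _ _ => rfl) (fun _ _ => rfl))

lemma isOpen_openLayer (L : ℝ) : IsOpen (openLayer L) :=
  isOpen_Ioo.preimage (continuous_apply 0)

lemma openLayer_subset_closedLayer (L : ℝ) : openLayer L ⊆ closedLayer L :=
  fun _ hp => Ioo_subset_Icc_self hp

lemma openLayer_subset_interior (L : ℝ) : openLayer L ⊆ interior (closedLayer L) :=
  interior_maximal (openLayer_subset_closedLayer L) (isOpen_openLayer L)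

lemma closedLayer_mem_nhds {L : ℝ} {p : Fin 3 → ℝ} (hp : p ∈ openLayer L) :
    closedLayer L ∈ nhds p :=
  mem_interior_iff_mem_nhds.1 (openLayer_subset_interior L hp)

lemma interior_closedLayer_nonempty {L : ℝ} (hL : 0 < L) :
    (interior (closedLayer L)).Nonempty :=
  ⟨fun _ => L / 2, openLayer_subset_interior L ⟨by simpa using hL, by simpa using hL⟩⟩

lemma uniqueDiffOn_closedLayer {L : ℝ} (hL : 0 < L) : UniqueDiffOn ℝ (closedLayer L) :=
  uniqueDiffOn_convex (convex_closedLayer L) (interior_closedLayer_nonempty hL)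

lemma closedLayer_subset_closure_interior {L : ℝ} (hL : 0 < L) :
    closedLayer L ⊆ closure (interior (closedLayer L)) := by
  rw [(convex_closedLayer L).closure_interior_eq_closure_of_nonempty_interior
    (interior_closedLayer_nonempty hL)]
  exact subset_closure

/-- The curl of a vector field on the closed layer. -/
noncomputable def layerCurl (L : ℝ) (u : (Fin 3 → ℝ) → (Fin 3 → ℝ)) (p : Fin 3 → ℝ) :
    Fin 3 → ℝ :=
  ![layerGrad L (fun q => u q 2) p 1 - layerGrad L (fun q => u q 1) p 2,
    layerGrad L (fun q => u q 0) p 2 - layerGrad L (fun q => u q 2) p 0,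
    layerGrad L (fun q => u q 1) p 0 - layerGrad L (fun q => u q 0) p 1]

section Pointwise

variable {L : ℝ} {p : Fin 3 → ℝ}

lemma layerDiv_eq (u : (Fin 3 → ℝ) → (Fin 3 → ℝ)) :
    layerDiv L u p = layerGrad L (fun q => u q 0) p 0 + layerGrad L (fun q => u q 1) p 1
      + layerGrad L (fun q => u q 2) p 2 :=
  Fin.sum_univ_three _

lemma layerGrad_add (hL : 0 < L) (hp : p ∈ closedLayer L) {φ ψ : (Fin 3 → ℝ) → ℝ}
    (hφ : DifferentiableWithinAt ℝ φ (closedLayer L) p)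
    (hψ : DifferentiableWithinAt ℝ ψ (closedLayer L) p) :
    layerGrad L (fun q => φ q + ψ q) p = layerGrad L φ p + layerGrad L ψ p := by
  funext i
  simp [layerGrad, fderivWithin_fun_add (uniqueDiffOn_closedLayer hL p hp) hφ hψ]

lemma layerGrad_sub (hL : 0 < L) (hp : p ∈ closedLayer L) {φ ψ : (Fin 3 → ℝ) → ℝ}
    (hφ : DifferentiableWithinAt ℝ φ (closedLayer L) p)
    (hψ : DifferentiableWithinAt ℝ ψ (closedLayer L) p) :
    layerGrad L (fun q => φ q - ψ q) p = layerGrad L φ p - layerGrad L ψ p := by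
  funext i
  simp [layerGrad, fderivWithin_fun_sub (uniqueDiffOn_closedLayer hL p hp) hφ hψ]

lemma layerGrad_mul (hL : 0 < L) (hp : p ∈ closedLayer L) {φ ψ : (Fin 3 → ℝ) → ℝ}
    (hφ : DifferentiableWithinAt ℝ φ (closedLayer L) p)
    (hψ : DifferentiableWithinAt ℝ ψ (closedLayer L) p) :
    layerGrad L (fun q => φ q * ψ q) p = φ p • layerGrad L ψ p + ψ p • layerGrad L φ p := by
  funext i
  simp [layerGrad, fderivWithin_fun_mul (uniqueDiffOn_closedLayer hL p hp) hφ hψ]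

lemma layerDiv_add (hL : 0 < L) (hp : p ∈ closedLayer L) {u w : (Fin 3 → ℝ) → (Fin 3 → ℝ)}
    (hu : DifferentiableWithinAt ℝ u (closedLayer L) p)
    (hw : DifferentiableWithinAt ℝ w (closedLayer L) p) :
    layerDiv L (fun q => u q + w q) p = layerDiv L u p + layerDiv L w p := by
  have hu := differentiableWithinAt_pi.1 hu
  have hw := differentiableWithinAt_pi.1 hw
  simp only [layerDiv_eq, Pi.add_apply, layerGrad_add hL hp (hu _) (hw _)]
  ring

lemma layerDiv_sub (hL : 0 < L) (hp : p ∈ closedLayer L) {u w : (Fin 3 → ℝ) → (Fin 3 → ℝ)}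
    (hu : DifferentiableWithinAt ℝ u (closedLayer L) p)
    (hw : DifferentiableWithinAt ℝ w (closedLayer L) p) :
    layerDiv L (fun q => u q - w q) p = layerDiv L u p - layerDiv L w p := by
  have hu := differentiableWithinAt_pi.1 hu
  have hw := differentiableWithinAt_pi.1 hw
  simp only [layerDiv_eq, Pi.sub_apply, layerGrad_sub hL hp (hu _) (hw _)]
  ring

lemma layerDiv_smul (hL : 0 < L) (hp : p ∈ closedLayer L) {φ : (Fin 3 → ℝ) → ℝ}
    {u : (Fin 3 → ℝ) → (Fin 3 → ℝ)}
    (hφ : DifferentiableWithinAt ℝ φ (closedLayer L) p)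
    (hu : DifferentiableWithinAt ℝ u (closedLayer L) p) :
    layerDiv L (fun q => φ q • u q) p = layerGrad L φ p ⬝ᵥ u p + φ p * layerDiv L u p := by
  have hu := differentiableWithinAt_pi.1 hu
  simp only [layerDiv_eq, Pi.smul_apply, smul_eq_mul, layerGrad_mul hL hp hφ (hu _),
    Pi.add_apply, dotProduct, Fin.sum_univ_three]
  ring

lemma layerDiv_cross (hL : 0 < L) (hp : p ∈ closedLayer L) {u w : (Fin 3 → ℝ) → (Fin 3 → ℝ)}
    (hu : DifferentiableWithinAt ℝ u (closedLayer L) p)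
    (hw : DifferentiableWithinAt ℝ w (closedLayer L) p) :
    layerDiv L (fun q => u q ⨯₃ w q) p
      = w p ⬝ᵥ layerCurl L u p - u p ⬝ᵥ layerCurl L w p := by
  have hu := differentiableWithinAt_pi.1 hu
  have hw := differentiableWithinAt_pi.1 hw
  have huw : ∀ i k, DifferentiableWithinAt ℝ (fun q => u q i * w q k) (closedLayer L) p :=
    fun i k => (hu i).mul (hw k)
  simp only [layerDiv_eq, cross_apply, layerCurl, Matrix.cons_val,
    layerGrad_sub hL hp (huw _ _) (huw _ _), layerGrad_mul hL hp (hu _) (hw _),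
    Pi.add_apply, Pi.sub_apply, Pi.smul_apply, smul_eq_mul, dotProduct, Fin.sum_univ_three]
  ring

lemma contDiffOn_layerGrad (hL : 0 < L) {n : ℕ} {φ : (Fin 3 → ℝ) → ℝ}
    (hφ : ContDiffOn ℝ (n + 1 : ℕ) φ (closedLayer L)) :
    ContDiffOn ℝ n (layerGrad L φ) (closedLayer L) := by
  refine contDiffOn_pi.2 fun i => ?_
  exact (hφ.fderivWithin (uniqueDiffOn_closedLayer hL) (by norm_cast)).clm_apply contDiffOn_const

lemma layerGrad_layerGrad (hL : 0 < L) (hp : p ∈ closedLayer L) {φ : (Fin 3 → ℝ) → ℝ}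
    (hφ : ContDiffOn ℝ 2 φ (closedLayer L)) (i k : Fin 3) :
    layerGrad L (fun q => layerGrad L φ q i) p k
      = fderivWithin ℝ (fderivWithin ℝ φ (closedLayer L)) (closedLayer L) p
          (Pi.single k 1) (Pi.single i 1) := by
  have hU := uniqueDiffOn_closedLayer hL
  have hd : DifferentiableWithinAt ℝ (fderivWithin ℝ φ (closedLayer L)) (closedLayer L) p :=
    ((hφ.fderivWithin (m := 1) hU (by norm_num)).differentiableOn (by norm_num)) p hp
  simp only [layerGrad]
  rw [fderivWithin_clm_apply (hU p hp) hd (differentiableWithinAt_const _)]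
  simp

lemma layerGrad_layerGrad_comm (hL : 0 < L) (hp : p ∈ closedLayer L) {φ : (Fin 3 → ℝ) → ℝ}
    (hφ : ContDiffOn ℝ 2 φ (closedLayer L)) (i k : Fin 3) :
    layerGrad L (fun q => layerGrad L φ q i) p k
      = layerGrad L (fun q => layerGrad L φ q k) p i := by
  rw [layerGrad_layerGrad hL hp hφ, layerGrad_layerGrad hL hp hφ]
  exact (hφ p hp).isSymmSndFDerivWithinAt (by simp) (uniqueDiffOn_closedLayer hL)
    (closedLayer_subset_closure_interior hL hp) hp _ _

lemma layerCurl_layerGrad (hL : 0 < L) (hp : p ∈ closedLayer L) {φ : (Fin 3 → ℝ) → ℝ}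
    (hφ : ContDiffOn ℝ 2 φ (closedLayer L)) : layerCurl L (layerGrad L φ) p = 0 := by
  rw [layerCurl, layerGrad_layerGrad_comm hL hp hφ 2 1, layerGrad_layerGrad_comm hL hp hφ 0 2,
    layerGrad_layerGrad_comm hL hp hφ 1 0]
  ext i; fin_cases i <;> simp

end Pointwise

lemma ContDiffOn.cross {E : Type*} [NormedAddCommGroup E] [NormedSpace ℝ E] {n : ℕ∞ω} {s : Set E}
    {u w : E → Fin 3 → ℝ} (hu : ContDiffOn ℝ n u s) (hw : ContDiffOn ℝ n w s) :
    ContDiffOn ℝ n (fun q => u q ⨯₃ w q) s := by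
  have hu := contDiffOn_pi.1 hu
  have hw := contDiffOn_pi.1 hw
  refine contDiffOn_pi.2 fun i => ?_
  fin_cases i
  · exact ((hu 1).mul (hw 2)).sub ((hu 2).mul (hw 1))
  · exact ((hu 2).mul (hw 0)).sub ((hu 0).mul (hw 2))
  · exact ((hu 0).mul (hw 1)).sub ((hu 1).mul (hw 0))

/-! ### Periodicity and the divergence theorem on a periodicity cell -/

section Periodic

variable {E E' : Type*} {L P₁ P₂ : ℝ}

lemma add_single_mem_closedLayer {p : Fin 3 → ℝ} {i : Fin 3} (hi : i ≠ 0) (t : ℝ) :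
    p + Pi.single i t ∈ closedLayer L ↔ p ∈ closedLayer L := by
  simp [mem_closedLayer, Pi.single_eq_of_ne' hi]

lemma LayerPeriodic.comp {u : (Fin 3 → ℝ) → E} (hu : LayerPeriodic L P₁ P₂ u) (Φ : E → E') :
    LayerPeriodic L P₁ P₂ (fun p => Φ (u p)) :=
  fun p hp => ⟨congrArg Φ (hu p hp).1, congrArg Φ (hu p hp).2⟩

lemma LayerPeriodic.prodMk {u : (Fin 3 → ℝ) → E} {w : (Fin 3 → ℝ) → E'}
    (hu : LayerPeriodic L P₁ P₂ u) (hw : LayerPeriodic L P₁ P₂ w) :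
    LayerPeriodic L P₁ P₂ (fun p => (u p, w p)) :=
  fun p hp => ⟨Prod.ext (hu p hp).1 (hw p hp).1, Prod.ext (hu p hp).2 (hw p hp).2⟩

lemma exists_int_translate_mem_Icc {P : ℝ} (hP : 0 < P) (t : ℝ) :
    ∃ n : ℤ, t + n * P ∈ Icc 0 P := by
  refine ⟨-⌊t / P⌋, ?_⟩
  have h1 := Int.floor_le (t / P)
  have h2 := Int.lt_floor_add_one (t / P)
  rw [le_div_iff₀ hP] at h1
  rw [div_lt_iff₀ hP] at h2
  push_cast
  constructor <;> nlinarith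

lemma eq_add_single_int_mul {u : (Fin 3 → ℝ) → E} {i : Fin 3} (hi : i ≠ 0) {P : ℝ}
    (h : ∀ p ∈ closedLayer L, u (p + Pi.single i P) = u p) (n : ℤ) :
    ∀ p ∈ closedLayer L, u (p + Pi.single i (n * P)) = u p := by
  induction n using Int.induction_on with
  | zero => intro p _; simp
  | succ n ih =>
    intro p hp
    have := h (p + Pi.single i (n * P)) ((add_single_mem_closedLayer hi _).2 hp)
    rw [add_assoc, ← Pi.single_add] at this
    rw [show (((n : ℤ) + 1 : ℤ) : ℝ) * P = n * P + P by push_cast; ring, this]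
    exact_mod_cast ih p hp
  | pred n ih =>
    intro p hp
    have := h (p + Pi.single i ((-(n : ℤ) - 1 : ℤ) * P)) ((add_single_mem_closedLayer hi _).2 hp)
    rw [add_assoc, ← Pi.single_add] at this
    rw [← this, ← ih p hp]
    congr 3
    push_cast; ring

lemma LayerPeriodic.exists_mem_closedCell {u : (Fin 3 → ℝ) → E} (hP₁ : 0 < P₁) (hP₂ : 0 < P₂)
    (hu : LayerPeriodic L P₁ P₂ u) {p : Fin 3 → ℝ} (hp : p ∈ closedLayer L) :
    ∃ q ∈ closedCell L P₁ P₂, u q = u p := by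
  obtain ⟨n, hn⟩ := exists_int_translate_mem_Icc hP₁ (p 1)
  obtain ⟨m, hm⟩ := exists_int_translate_mem_Icc hP₂ (p 2)
  have hp' := (add_single_mem_closedLayer (p := p) (i := 1) (by decide) (n * P₁)).2 hp
  refine ⟨p + Pi.single 1 (n * P₁) + Pi.single 2 (m * P₂), ⟨?_, ?_, ?_⟩, ?_⟩
  · simpa using mem_closedLayer.1 hp
  · simpa using hn
  · simpa using hm
  · rw [eq_add_single_int_mul (by decide) (fun q hq => (hu q hq).2) m _ hp',
      eq_add_single_int_mul (by decide) (fun q hq => (hu q hq).1) n _ hp]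

open scoped Pointwise in
lemma fderivWithin_add_single_of_periodic [NormedAddCommGroup E] [NormedSpace ℝ E]
    {u : (Fin 3 → ℝ) → E} {i : Fin 3} (hi : i ≠ 0) {P : ℝ}
    (h : ∀ p ∈ closedLayer L, u (p + Pi.single i P) = u p) {p : Fin 3 → ℝ}
    (hp : p ∈ closedLayer L) :
    fderivWithin ℝ u (closedLayer L) (p + Pi.single i P) = fderivWithin ℝ u (closedLayer L) p := by
  have hs : (Pi.single i P : Fin 3 → ℝ) +ᵥ closedLayer L = closedLayer L := by
    ext q
    rw [Set.mem_vadd_set_iff_neg_vadd_mem, vadd_eq_add, add_comm, ← Pi.single_neg]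
    exact add_single_mem_closedLayer hi _
  have := fderivWithin_comp_add_right (𝕜 := ℝ) (f := u) (s := closedLayer L) (x := p)
    (Pi.single i P)
  rw [hs] at this
  rw [← this]
  exact fderivWithin_congr h (h p hp)

lemma LayerPeriodic.fderivWithin [NormedAddCommGroup E] [NormedSpace ℝ E]
    {u : (Fin 3 → ℝ) → E} (hu : LayerPeriodic L P₁ P₂ u) :
    LayerPeriodic L P₁ P₂ (fderivWithin ℝ u (closedLayer L)) :=
  fun _ hp => ⟨fderivWithin_add_single_of_periodic (by decide) (fun q hq => (hu q hq).1) hp,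
    fderivWithin_add_single_of_periodic (by decide) (fun q hq => (hu q hq).2) hp⟩

lemma eq_Icc_closedCell (L P₁ P₂ : ℝ) : closedCell L P₁ P₂ = Icc 0 ![L, P₁, P₂] := by
  ext p
  simp only [closedCell, mem_ofPred_eq, mem_Icc, Pi.le_def, Fin.forall_fin_succ]
  simp
  tauto

lemma closedCell_subset_closedLayer (L P₁ P₂ : ℝ) : closedCell L P₁ P₂ ⊆ closedLayer L :=
  fun _ hp => hp.1

lemma ContDiffOn.continuousOn_layerDiv (hL : 0 < L) {U : (Fin 3 → ℝ) → (Fin 3 → ℝ)}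
    (hU : ContDiffOn ℝ 1 U (closedLayer L)) : ContinuousOn (layerDiv L U) (closedLayer L) := by
  refine continuousOn_finsetSum _ fun i _ => ?_
  exact ((contDiffOn_pi.1 hU i).continuousOn_fderivWithin (uniqueDiffOn_closedLayer hL)
    le_rfl).clm_apply continuousOn_const

/-- The fluxes of a periodic field through opposite lateral faces of the cell cancel, so that its
divergence has mean value zero if it vanishes on the planes `x = 0` and `x = L`. -/
lemma integral_layerDiv_eq_zero (hL : 0 < L) (hP₁ : 0 < P₁) (hP₂ : 0 < P₂)
    {U : (Fin 3 → ℝ) → (Fin 3 → ℝ)} (hU : ContDiffOn ℝ 1 U (closedLayer L))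
    (hper : LayerPeriodic L P₁ P₂ U) (h0 : ∀ p, p 0 = 0 ∨ p 0 = L → U p = 0) :
    ∫ p in closedCell L P₁ P₂, layerDiv L U p = 0 := by
  have hsub : Icc 0 ![L, P₁, P₂] ⊆ closedLayer L :=
    eq_Icc_closedCell L P₁ P₂ ▸ closedCell_subset_closedLayer L P₁ P₂
  have hle : (0 : Fin 3 → ℝ) ≤ ![L, P₁, P₂] := by
    intro i; fin_cases i <;> simp [hL.le, hP₁.le, hP₂.le]
  have key := MeasureTheory.integral_divergence_of_hasFDerivAt_off_countable'
    (0 : Fin 3 → ℝ) ![L, P₁, P₂] hle (fun i q => U q i)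
    (fun i => fderivWithin ℝ (fun q => U q i) (closedLayer L)) ∅ countable_empty
    (fun i => (contDiffOn_pi.1 hU i).continuousOn.mono hsub) ?_ ?_
  · rw [eq_Icc_closedCell]
    refine Eq.trans key ?_
    refine Finset.sum_eq_zero fun i _ => ?_
    rw [sub_eq_zero]
    refine MeasureTheory.setIntegral_congr_fun measurableSet_Icc fun x hx => ?_
    have hx0 : i ≠ 0 → (Fin.insertNth i 0 x : Fin 3 → ℝ) ∈ closedLayer L := by
      intro hi
      have h1 := hx.1 0
      have h2 := hx.2 0
      fin_cases i
      · exact absurd rfl hi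
      · exact ⟨h1, h2⟩
      · exact ⟨h1, h2⟩
    fin_cases i
    · exact (congrFun (h0 (Fin.insertNth 0 L x) (Or.inr rfl)) 0).trans
        (congrFun (h0 (Fin.insertNth 0 0 x) (Or.inl rfl)) 0).symm
    · have h := (hper _ (hx0 (by decide))).1
      have e : (Fin.insertNth 1 0 x : Fin 3 → ℝ) + Pi.single 1 P₁ = Fin.insertNth 1 P₁ x := by
        ext k; fin_cases k <;> simp [Fin.insertNth, Fin.succAboveCases]
      exact congrFun ((congrArg U e).symm.trans h) 1
    · have h := (hper _ (hx0 (by decide))).2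
      have e : (Fin.insertNth 2 0 x : Fin 3 → ℝ) + Pi.single 2 P₂ = Fin.insertNth 2 P₂ x := by
        ext k; fin_cases k <;> simp [Fin.insertNth, Fin.succAboveCases]
      exact congrFun ((congrArg U e).symm.trans h) 2
  · intro x hx i
    have hx0 := hx.1 0 (mem_univ _)
    have hxo : x ∈ openLayer L := hx0
    have hxc := openLayer_subset_closedLayer L hxo
    have hd := (contDiffOn_pi.1 hU i).differentiableOn (by norm_num) x hxc
    exact hd.hasFDerivWithinAt.hasFDerivAt (closedLayer_mem_nhds hxo)
  · exact ((hU.continuousOn_layerDiv hL).mono hsub).integrableOn_compact isCompact_Icc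

end Periodic

/-! ### Pointwise algebra of the second variation -/

section Algebra

/-- Expansion of `w ⬝ᵥ j` in the frame `v`, `B × v`, `v × A`, where `v = A × B`. The dual frame of
the last two vectors is `A / |v|²`, `B / |v|²`. -/
lemma velocity_frame_expansion (A B j w : Fin 3 → ℝ) :
    (A ⨯₃ B ⬝ᵥ A ⨯₃ B) * (w ⬝ᵥ j)
      = (A ⨯₃ B ⬝ᵥ j) * (A ⨯₃ B ⬝ᵥ w) + (A ⬝ᵥ j) * (B ⨯₃ (A ⨯₃ B) ⬝ᵥ w)
        + (B ⬝ᵥ j) * ((A ⨯₃ B) ⨯₃ A ⬝ᵥ w) := by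
  simp only [cross_apply, dotProduct, Fin.sum_univ_three, Matrix.cons_val]
  ring

/-- The difference of the fluxes at `(A, B) ± ½ (φ, γ)`, tested with `(φ, γ)`. It equals
`|W|² + 2 v · X + ½ |X|²` with `v = A × B`, `W = φ × B + A × γ` and `X = φ × γ`; the terms of odd
order in `(φ, γ)` cancel since the difference is centred. -/
lemma flux_difference_identity (A B φ γ A₁ B₁ A₂ B₂ : Fin 3 → ℝ)
    (hA₁ : A₁ = A + (1 / 2 : ℝ) • φ) (hB₁ : B₁ = B + (1 / 2 : ℝ) • γ)
    (hA₂ : A₂ = A - (1 / 2 : ℝ) • φ) (hB₂ : B₂ = B - (1 / 2 : ℝ) • γ) :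
    φ ⬝ᵥ (B₁ ⨯₃ (A₁ ⨯₃ B₁) - B₂ ⨯₃ (A₂ ⨯₃ B₂)) + γ ⬝ᵥ ((A₁ ⨯₃ B₁) ⨯₃ A₁ - (A₂ ⨯₃ B₂) ⨯₃ A₂)
      = (φ ⨯₃ B + A ⨯₃ γ) ⬝ᵥ (φ ⨯₃ B + A ⨯₃ γ) + 2 * (φ ⬝ᵥ γ ⨯₃ (A ⨯₃ B))
        + 1 / 2 * (φ ⨯₃ γ ⬝ᵥ φ ⨯₃ γ) := by
  subst hA₁ hB₁ hA₂ hB₂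
  simp only [cross_apply, dotProduct, Fin.sum_univ_three, Matrix.cons_val, Pi.add_apply,
    Pi.sub_apply, Pi.smul_apply, smul_eq_mul]
  ring

lemma dotProduct_self_nonneg_three (w : Fin 3 → ℝ) : 0 ≤ w ⬝ᵥ w :=
  Finset.sum_nonneg fun i _ => mul_self_nonneg (w i)

lemma sq_dotProduct_le (u w : Fin 3 → ℝ) : (u ⬝ᵥ w) ^ 2 ≤ (u ⬝ᵥ u) * (w ⬝ᵥ w) := by
  have := Finset.sum_mul_sq_le_sq_mul_sq Finset.univ u w
  simpa [dotProduct, sq] using this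

/-- The linearised velocity `W = φ × B + A × γ` controls the derivatives along `v = A × B` and the
combination `(B × v) ⬝ᵥ φ + (v × A) ⬝ᵥ γ` of transverse derivatives: these are, up to sign, its
products with `A`, `B` and `v`. -/
lemma linearized_velocity_controls (A B φ γ : Fin 3 → ℝ) :
    (A ⨯₃ B ⬝ᵥ φ) ^ 2 ≤ (A ⬝ᵥ A) * ((φ ⨯₃ B + A ⨯₃ γ) ⬝ᵥ (φ ⨯₃ B + A ⨯₃ γ)) ∧
    (A ⨯₃ B ⬝ᵥ γ) ^ 2 ≤ (B ⬝ᵥ B) * ((φ ⨯₃ B + A ⨯₃ γ) ⬝ᵥ (φ ⨯₃ B + A ⨯₃ γ)) ∧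
    (B ⨯₃ (A ⨯₃ B) ⬝ᵥ φ + (A ⨯₃ B) ⨯₃ A ⬝ᵥ γ) ^ 2
      ≤ (A ⨯₃ B ⬝ᵥ A ⨯₃ B) * ((φ ⨯₃ B + A ⨯₃ γ) ⬝ᵥ (φ ⨯₃ B + A ⨯₃ γ)) := by
  refine ⟨?_, ?_, ?_⟩
  · convert sq_dotProduct_le A (φ ⨯₃ B + A ⨯₃ γ) using 1
    simp only [cross_apply, dotProduct, Fin.sum_univ_three, Matrix.cons_val, Pi.add_apply]
    ring
  · convert sq_dotProduct_le B (φ ⨯₃ B + A ⨯₃ γ) using 1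
    simp only [cross_apply, dotProduct, Fin.sum_univ_three, Matrix.cons_val, Pi.add_apply]
    ring
  · convert sq_dotProduct_le (A ⨯₃ B) (φ ⨯₃ B + A ⨯₃ γ) using 1
    simp only [cross_apply, dotProduct, Fin.sum_univ_three, Matrix.cons_val, Pi.add_apply]
    ring

lemma two_mul_mul_ge_neg {ε lam s t Q : ℝ} (hlam : |lam| ≤ ε) (ht : t ^ 2 ≤ Q) :
    -(ε * (s ^ 2 + Q)) ≤ 2 * lam * s * t := by
  obtain ⟨h1, h2⟩ := abs_le.1 hlam
  have hε : 0 ≤ ε := (abs_nonneg _).trans hlam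
  nlinarith [mul_nonneg (sub_nonneg.2 h2) (sq_nonneg (s - t)),
    mul_nonneg (sub_nonneg.2 h1) (sq_nonneg (s + t)), mul_le_mul_of_nonneg_left ht hε]

/-- Coercivity: the square `N` of the linearised velocity and the weight term coming from the field
`x (F² + G²) v` absorb all the small terms. -/
lemma coercivity_estimate {F G N α β S lam p q d₁ d₂ d₃ h x v₀ σ L M c ε κ : ℝ}
    (hL : 0 < L) (hM : 0 < M) (hc : 0 < c) (hκ : κ = c / (8 * L ^ 2 * M))
    (hε : 3 * ε * M ≤ 1 / 2) (hε' : 4 * ε ≤ κ * c / 8)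
    (hN : 0 ≤ N) (hα : α ^ 2 ≤ M * N) (hβ : β ^ 2 ≤ M * N) (hS : S ^ 2 ≤ M * N)
    (hlam : |lam| ≤ ε) (hp : |p| ≤ ε) (hq : |q| ≤ ε)
    (h₁ : |d₁| ≤ ε) (h₂ : |d₂| ≤ ε) (h₃ : |d₃| ≤ ε)
    (hx : 0 ≤ x) (hxL : x ≤ L) (hσ : |σ| = 1) (hv : c ≤ σ * v₀)
    (hh : -(κ * c / 8 * (F ^ 2 + G ^ 2)) ≤ h) :
    κ * c / 4 * (F ^ 2 + G ^ 2)
      ≤ N + h + 2 * lam * F * β + 2 * q * F * S - 2 * p * G * S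
        + F ^ 2 * d₁ - 2 * (F * G) * d₂ - G ^ 2 * d₃
        + κ * (σ * v₀ * (F ^ 2 + G ^ 2) + 2 * (σ * x) * (F * α + G * β)) := by
  have hκ0 : 0 < κ := by rw [hκ]; positivity
  have e1 := two_mul_mul_ge_neg (s := F) hlam hβ
  have e2 := two_mul_mul_ge_neg (s := F) hq hS
  have e3 := two_mul_mul_ge_neg (s := G) (by rwa [abs_neg] : |-p| ≤ ε) hS
  have f1 : -(ε * F ^ 2) ≤ F ^ 2 * d₁ := by nlinarith [(abs_le.1 h₁).1, sq_nonneg F]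
  have f2 := two_mul_mul_ge_neg (s := F) (t := G) (by rwa [abs_neg] : |-d₂| ≤ ε) le_rfl
  have f3 : -(ε * G ^ 2) ≤ -(G ^ 2 * d₃) := by nlinarith [(abs_le.1 h₃).2, sq_nonneg G]
  have hσx : |σ * x| ≤ L := by rw [abs_mul, hσ, one_mul, abs_of_nonneg hx]; exact hxL
  -- the inequality `2 y s t ≥ -(c / 2) s² - (2 L² / c) t²` for `|y| ≤ L`
  have weight : ∀ s t : ℝ, t ^ 2 ≤ M * N →
      -(c / 2 * s ^ 2 + 2 * L ^ 2 * M / c * N) ≤ 2 * (σ * x) * (s * t) := by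
    intro s t ht
    have hsq : (σ * x) ^ 2 ≤ L ^ 2 := sq_le_sq' (abs_le.1 hσx).1 (abs_le.1 hσx).2
    have h1 : 0 ≤ (c * s + 2 * (σ * x) * t) ^ 2 := sq_nonneg _
    have h2 : (σ * x) ^ 2 * t ^ 2 ≤ L ^ 2 * (M * N) :=
      mul_le_mul hsq ht (sq_nonneg _) (sq_nonneg _)
    have h3 : 0 ≤ 1 / (2 * c) := by positivity
    have h4 : 1 / (2 * c) * (c * s + 2 * (σ * x) * t) ^ 2
        = c / 2 * s ^ 2 + 2 * (σ * x) * (s * t) + 2 / c * ((σ * x) ^ 2 * t ^ 2) := by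
      field_simp
      ring
    have h5 : 2 / c * ((σ * x) ^ 2 * t ^ 2) ≤ 2 / c * (L ^ 2 * (M * N)) :=
      mul_le_mul_of_nonneg_left h2 (by positivity)
    have h6 : 2 / c * (L ^ 2 * (M * N)) = 2 * L ^ 2 * M / c * N := by ring
    have := mul_nonneg h3 h1
    linarith
  have w1 := mul_le_mul_of_nonneg_left (weight F α hα) hκ0.le
  have w2 := mul_le_mul_of_nonneg_left (weight G β hβ) hκ0.le
  have hκN : κ * (2 * L ^ 2 * M / c * N) = 1 / 4 * N := by
    rw [hκ]; field_simp; ring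
  have w3 : κ * (c * (F ^ 2 + G ^ 2)) ≤ κ * (σ * v₀ * (F ^ 2 + G ^ 2)) := by gcongr
  have hεN : 3 * ε * M * N ≤ 1 / 2 * N := mul_le_mul_of_nonneg_right hε hN
  have hεF : 4 * ε * (F ^ 2 + G ^ 2) ≤ κ * c / 8 * (F ^ 2 + G ^ 2) :=
    mul_le_mul_of_nonneg_right hε' (by positivity)
  have hεG : 0 ≤ ε * G ^ 2 := mul_nonneg ((abs_nonneg _).trans hp) (sq_nonneg G)
  linarith

end Algebra

/-! ### Functions of the first-order jet of a pair of gradients -/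

/-- The values `(A, B)` of a pair of vector fields on `ℝ³`. -/
abbrev GradPair := (Fin 3 → ℝ) × (Fin 3 → ℝ)

/-- The values of a pair of vector fields together with its first derivative. -/
abbrev GradJet := GradPair × ((Fin 3 → ℝ) →L[ℝ] GradPair)

/-- The velocity `v = A × B`. -/
noncomputable def jetVelocity (T : GradJet) : Fin 3 → ℝ := T.1.1 ⨯₃ T.1.2

/-- The `i`-th partial derivative of `v = A × B`. -/
noncomputable def jetVelocityPartial (i : Fin 3) (T : GradJet) : Fin 3 → ℝ :=
  (T.2 (Pi.single i 1)).1 ⨯₃ T.1.2 + T.1.1 ⨯₃ (T.2 (Pi.single i 1)).2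

/-- The curl `j` of `v = A × B`. -/
noncomputable def jetVorticity (T : GradJet) : Fin 3 → ℝ :=
  ![jetVelocityPartial 1 T 2 - jetVelocityPartial 2 T 1,
    jetVelocityPartial 2 T 0 - jetVelocityPartial 0 T 2,
    jetVelocityPartial 0 T 1 - jetVelocityPartial 1 T 0]

/-- The coefficient of `j` along `v` in the frame `v`, `B × v`, `v × A`. -/
noncomputable def jetCoeffV (T : GradJet) : ℝ :=
  (jetVelocity T ⬝ᵥ jetVorticity T) / (jetVelocity T ⬝ᵥ jetVelocity T)

/-- The coefficient of `j` along `B × v` in the frame `v`, `B × v`, `v × A`. -/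
noncomputable def jetCoeffA (T : GradJet) : ℝ :=
  (T.1.1 ⬝ᵥ jetVorticity T) / (jetVelocity T ⬝ᵥ jetVelocity T)

/-- The coefficient of `j` along `v × A` in the frame `v`, `B × v`, `v × A`. -/
noncomputable def jetCoeffB (T : GradJet) : ℝ :=
  (T.1.2 ⬝ᵥ jetVorticity T) / (jetVelocity T ⬝ᵥ jetVelocity T)

/-- The frame vector `B × v`. -/
noncomputable def jetFrameA (T : GradJet) : Fin 3 → ℝ := T.1.2 ⨯₃ jetVelocity T

/-- The frame vector `v × A`. -/
noncomputable def jetFrameB (T : GradJet) : Fin 3 → ℝ := jetVelocity T ⨯₃ T.1.1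

section Smooth

variable {E : Type*} [NormedAddCommGroup E] [NormedSpace ℝ E] {n : ℕ∞ω}

lemma ContDiffAt.cross {u w : E → Fin 3 → ℝ} {x : E} (hu : ContDiffAt ℝ n u x)
    (hw : ContDiffAt ℝ n w x) : ContDiffAt ℝ n (fun q => u q ⨯₃ w q) x := by
  have hu := contDiffAt_pi.1 hu
  have hw := contDiffAt_pi.1 hw
  refine contDiffAt_pi.2 fun i => ?_
  fin_cases i
  · exact ((hu 1).mul (hw 2)).sub ((hu 2).mul (hw 1))
  · exact ((hu 2).mul (hw 0)).sub ((hu 0).mul (hw 2))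
  · exact ((hu 0).mul (hw 1)).sub ((hu 1).mul (hw 0))

lemma ContDiffAt.dotProduct {u w : E → Fin 3 → ℝ} {x : E} (hu : ContDiffAt ℝ n u x)
    (hw : ContDiffAt ℝ n w x) : ContDiffAt ℝ n (fun q => u q ⬝ᵥ w q) x :=
  ContDiffAt.sum fun i _ => (contDiffAt_pi.1 hu i).mul (contDiffAt_pi.1 hw i)

variable {T : GradJet}

lemma contDiffAt_jet_fst : ContDiffAt ℝ n (fun T : GradJet => T.1.1) T :=
  (contDiff_fst.comp contDiff_fst).contDiffAt

lemma contDiffAt_jet_snd : ContDiffAt ℝ n (fun T : GradJet => T.1.2) T :=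
  (contDiff_snd.comp contDiff_fst).contDiffAt

lemma contDiffAt_jetVelocity : ContDiffAt ℝ n jetVelocity T :=
  contDiffAt_jet_fst.cross contDiffAt_jet_snd

lemma contDiffAt_jetVelocityPartial (i : Fin 3) : ContDiffAt ℝ n (jetVelocityPartial i) T := by
  have h : ContDiffAt ℝ n (fun T : GradJet => T.2 (Pi.single i 1)) T :=
    (contDiff_snd.clm_apply contDiff_const).contDiffAt
  exact (h.fst.cross contDiffAt_jet_snd).add (contDiffAt_jet_fst.cross h.snd)

lemma contDiffAt_jetVorticity : ContDiffAt ℝ n jetVorticity T := by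
  have h := fun i k => contDiffAt_pi.1 (contDiffAt_jetVelocityPartial (n := n) (T := T) i) k
  refine contDiffAt_pi.2 fun i => ?_
  fin_cases i
  · exact (h 1 2).sub (h 2 1)
  · exact (h 2 0).sub (h 0 2)
  · exact (h 0 1).sub (h 1 0)

lemma contDiffAt_jetCoeffV (hT : jetVelocity T ⬝ᵥ jetVelocity T ≠ 0) :
    ContDiffAt ℝ n jetCoeffV T :=
  (contDiffAt_jetVelocity.dotProduct contDiffAt_jetVorticity).div
    (contDiffAt_jetVelocity.dotProduct contDiffAt_jetVelocity) hT

lemma contDiffAt_jetCoeffA (hT : jetVelocity T ⬝ᵥ jetVelocity T ≠ 0) :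
    ContDiffAt ℝ n jetCoeffA T :=
  (contDiffAt_jet_fst.dotProduct contDiffAt_jetVorticity).div
    (contDiffAt_jetVelocity.dotProduct contDiffAt_jetVelocity) hT

lemma contDiffAt_jetCoeffB (hT : jetVelocity T ⬝ᵥ jetVelocity T ≠ 0) :
    ContDiffAt ℝ n jetCoeffB T :=
  (contDiffAt_jet_snd.dotProduct contDiffAt_jetVorticity).div
    (contDiffAt_jetVelocity.dotProduct contDiffAt_jetVelocity) hT

lemma contDiffAt_jetFrameA : ContDiffAt ℝ n jetFrameA T :=
  contDiffAt_jet_snd.cross contDiffAt_jetVelocity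

lemma contDiffAt_jetFrameB : ContDiffAt ℝ n jetFrameB T :=
  contDiffAt_jetVelocity.cross contDiffAt_jet_fst

lemma jetVorticity_of_constant (u : GradPair) : jetVorticity (u, 0) = 0 := by
  have : ∀ i, jetVelocityPartial i (u, 0) = 0 := by
    intro i; simp [jetVelocityPartial, cross_apply, ← List.ofFn_inj]
  ext i; fin_cases i <;> simp [jetVorticity, this]

/-- The derivative of a function of `T` that is `C¹` at `T₀` is bounded near `T₀`; hence the
divergence of its composition with a map is small if the derivative of that map is. -/
lemma ContDiffAt.eventually_abs_div_le {Ψ : E → Fin 3 → ℝ} {T₀ : E} (hΨ : ContDiffAt ℝ 1 Ψ T₀)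
    {ε : ℝ} (hε : 0 < ε) :
    ∃ r > 0, ∀ᶠ T in nhds T₀, ∀ D : (Fin 3 → ℝ) →L[ℝ] E, ‖D‖ < r →
      |∑ i, fderiv ℝ Ψ T (D (Pi.single i 1)) i| ≤ ε := by
  have hc : ContinuousAt (fun T => ‖fderiv ℝ Ψ T‖) T₀ :=
    (hΨ.fderiv_right (m := 0) (by norm_num)).continuousAt.norm
  set K := ‖fderiv ℝ Ψ T₀‖ + 1 with hK
  have hK0 : 0 < K := by positivity
  refine ⟨ε / (3 * K), by positivity, ?_⟩
  filter_upwards [hc.eventually (gt_mem_nhds (lt_add_one _))] with T hT D hD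
  have hterm : ∀ i : Fin 3, |fderiv ℝ Ψ T (D (Pi.single i 1)) i| ≤ ε / 3 := by
    intro i
    have h1 : |fderiv ℝ Ψ T (D (Pi.single i 1)) i| ≤ ‖fderiv ℝ Ψ T (D (Pi.single i 1))‖ :=
      norm_le_pi_norm (fderiv ℝ Ψ T (D (Pi.single i 1))) i
    have h2 : ‖D (Pi.single i 1)‖ ≤ ε / (3 * K) := by
      have := D.le_opNorm (Pi.single i 1)
      rw [Pi.norm_single, norm_one, mul_one] at this
      exact this.trans hD.le
    calc _ ≤ ‖fderiv ℝ Ψ T‖ * ‖D (Pi.single i 1)‖ := h1.trans ((fderiv ℝ Ψ T).le_opNorm _)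
      _ ≤ K * (ε / (3 * K)) := mul_le_mul hT.le h2 (norm_nonneg _) hK0.le
      _ = ε / 3 := by field_simp
  calc _ ≤ ∑ i : Fin 3, |fderiv ℝ Ψ T (D (Pi.single i 1)) i| := Finset.abs_sum_le_sum_abs _ _
    _ ≤ ∑ _i : Fin 3, ε / 3 := Finset.sum_le_sum fun i _ => hterm i
    _ = ε := by simp; ring

end Smooth

lemma layerDiv_comp {E : Type*} [NormedAddCommGroup E] [NormedSpace ℝ E] {L : ℝ} (hL : 0 < L)
    {p : Fin 3 → ℝ} (hp : p ∈ closedLayer L) {Ψ : E → Fin 3 → ℝ} {T : (Fin 3 → ℝ) → E}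
    (hΨ : DifferentiableAt ℝ Ψ (T p)) (hT : DifferentiableWithinAt ℝ T (closedLayer L) p) :
    layerDiv L (fun q => Ψ (T q)) p
      = ∑ i, fderiv ℝ Ψ (T p) (fderivWithin ℝ T (closedLayer L) p (Pi.single i 1)) i := by
  have hU := uniqueDiffOn_closedLayer hL p hp
  refine Finset.sum_congr rfl fun i _ => ?_
  have h := hΨ.hasFDerivAt.comp_hasFDerivWithinAt p hT.hasFDerivWithinAt
  have h' := (hasFDerivWithinAt_pi'.1 h i).fderivWithin hU
  simp only [Function.comp_def] at h'
  rw [h']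
  simp

/-- The first-order jet of a pair of vector fields on the closed layer. -/
noncomputable def layerJet (L : ℝ) (u : (Fin 3 → ℝ) → GradPair) (p : Fin 3 → ℝ) : GradJet :=
  (u p, fderivWithin ℝ u (closedLayer L) p)

lemma layerCurl_jetVelocity {L : ℝ} (hL : 0 < L) {p : Fin 3 → ℝ} (hp : p ∈ closedLayer L)
    {u : (Fin 3 → ℝ) → GradPair} (hu : DifferentiableWithinAt ℝ u (closedLayer L) p) :
    layerCurl L (fun q => jetVelocity (layerJet L u q)) p = jetVorticity (layerJet L u p) := by
  have hU := uniqueDiffOn_closedLayer hL p hp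
  have h1 : ∀ k, DifferentiableWithinAt ℝ (fun q => (u q).1 k) (closedLayer L) p :=
    differentiableWithinAt_pi.1 hu.fst
  have h2 : ∀ k, DifferentiableWithinAt ℝ (fun q => (u q).2 k) (closedLayer L) p :=
    differentiableWithinAt_pi.1 hu.snd
  have g1 : ∀ k i, layerGrad L (fun q => (u q).1 k) p i
      = (fderivWithin ℝ u (closedLayer L) p (Pi.single i 1)).1 k := by
    intro k i
    rw [layerGrad, (hasFDerivWithinAt_pi'.1 hu.hasFDerivWithinAt.fst k).fderivWithin hU]
    rfl
  have g2 : ∀ k i, layerGrad L (fun q => (u q).2 k) p i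
      = (fderivWithin ℝ u (closedLayer L) p (Pi.single i 1)).2 k := by
    intro k i
    rw [layerGrad, (hasFDerivWithinAt_pi'.1 hu.hasFDerivWithinAt.snd k).fderivWithin hU]
    rfl
  have h12 : ∀ i k, DifferentiableWithinAt ℝ (fun q => (u q).1 i * (u q).2 k) (closedLayer L) p :=
    fun i k => (h1 i).mul (h2 k)
  have key : ∀ i k, layerGrad L (fun q => jetVelocity (layerJet L u q) k) p i
      = jetVelocityPartial i (layerJet L u p) k := by
    intro i k
    fin_cases k <;>
    simp only [jetVelocity, layerJet, cross_apply, Matrix.cons_val, Fin.zero_eta, Fin.mk_one,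
      Fin.reduceFinMk, jetVelocityPartial,
      layerGrad_sub hL hp (h12 _ _) (h12 _ _), layerGrad_mul hL hp (h1 _) (h2 _),
      Pi.add_apply, Pi.sub_apply, Pi.smul_apply, smul_eq_mul, g1, g2] <;> ring
  simp only [layerCurl, jetVorticity, key]

/-- Uniform control of the jet functions near the constant jet `((a, b), 0)`. The coefficients of
`j` are small there because they vanish at constant jets. The sums in the last three bounds are the
divergences of the composed fields, see `layerDiv_comp`. -/
lemma exists_jet_control {a b : Fin 3 → ℝ} (hv : (a ⨯₃ b) 0 ≠ 0) :
    ∃ M > 0, ∃ c > 0, ∃ σ : ℝ, |σ| = 1 ∧ ∀ ε > 0, ∃ δ > 0, ∀ T : GradJet, ‖T - ((a, b), 0)‖ < δ →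
      c ≤ σ * jetVelocity T 0 ∧ T.1.1 ⬝ᵥ T.1.1 ≤ M ∧ T.1.2 ⬝ᵥ T.1.2 ≤ M ∧
      jetVelocity T ⬝ᵥ jetVelocity T ≤ M ∧
      |jetCoeffV T| ≤ ε ∧ |jetCoeffA T| ≤ ε ∧ |jetCoeffB T| ≤ ε ∧
      ∀ D : (Fin 3 → ℝ) →L[ℝ] GradJet, ‖D‖ < δ →
        |∑ i, fderiv ℝ (fun T => jetCoeffB T • jetFrameA T) T (D (Pi.single i 1)) i| ≤ ε ∧
        |∑ i, fderiv ℝ (fun T => jetCoeffA T • jetFrameA T) T (D (Pi.single i 1)) i| ≤ ε ∧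
        |∑ i, fderiv ℝ (fun T => jetCoeffA T • jetFrameB T) T (D (Pi.single i 1)) i| ≤ ε := by
  set T₀ : GradJet := ((a, b), 0) with hT₀
  have hv₀ : jetVelocity T₀ 0 ≠ 0 := hv
  have hvv : jetVelocity T₀ ⬝ᵥ jetVelocity T₀ ≠ 0 := by
    rw [Ne, dotProduct_self_eq_zero]
    exact fun h => hv₀ (congrFun h 0)
  have hj : jetVorticity T₀ = 0 := jetVorticity_of_constant _
  have cA := contDiffAt_jet_fst (n := 1) (T := T₀)
  have cB := contDiffAt_jet_snd (n := 1) (T := T₀)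
  have cv := contDiffAt_jetVelocity (n := 1) (T := T₀)
  have pA := contDiffAt_jetCoeffA (n := 1) hvv
  have pB := contDiffAt_jetCoeffB (n := 1) hvv
  have pV := contDiffAt_jetCoeffV (n := 1) hvv
  have bdd : ∀ φ : GradJet → ℝ, ContDiffAt ℝ 1 φ T₀ → ∀ M, φ T₀ < M → ∀ᶠ T in nhds T₀, φ T ≤ M :=
    fun φ hφ M hM => (hφ.continuousAt.eventually (gt_mem_nhds hM)).mono fun _ h => h.le
  have small : ∀ φ : GradJet → ℝ, ContDiffAt ℝ 1 φ T₀ → φ T₀ = 0 → ∀ ε > 0,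
      ∀ᶠ T in nhds T₀, |φ T| ≤ ε := by
    intro φ hφ h0 ε hε
    have : |φ T₀| < ε := by rwa [h0, abs_zero]
    exact (hφ.continuousAt.abs.eventually (gt_mem_nhds this)).mono fun _ h => h.le
  have nA := dotProduct_self_nonneg_three a
  have nB := dotProduct_self_nonneg_three b
  have nv := dotProduct_self_nonneg_three (jetVelocity T₀)
  set σ : ℝ := ((SignType.sign (jetVelocity T₀ 0) : SignType) : ℝ) with hσ
  have hσv : σ * jetVelocity T₀ 0 = |jetVelocity T₀ 0| := sign_mul_self _
  set M := a ⬝ᵥ a + b ⬝ᵥ b + jetVelocity T₀ ⬝ᵥ jetVelocity T₀ + 1 with hM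
  have h0 : 0 < |jetVelocity T₀ 0| := abs_pos.2 hv₀
  refine ⟨M, by linarith, |jetVelocity T₀ 0| / 2, by positivity, σ, ?_, ?_⟩
  · have := congrArg abs hσv
    rw [abs_mul, abs_abs] at this
    exact mul_right_cancel₀ h0.ne' (this.trans (one_mul _).symm)
  intro ε hε
  obtain ⟨r₁, hr₁, e₁⟩ := (pB.smul (contDiffAt_jetFrameA (n := 1))).eventually_abs_div_le hε
  obtain ⟨r₂, hr₂, e₂⟩ := (pA.smul (contDiffAt_jetFrameA (n := 1))).eventually_abs_div_le hε
  obtain ⟨r₃, hr₃, e₃⟩ := (pA.smul (contDiffAt_jetFrameB (n := 1))).eventually_abs_div_le hε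
  have ev : ∀ᶠ T in nhds T₀, |jetVelocity T₀ 0| / 2 ≤ σ * jetVelocity T 0 := by
    have hc : ContinuousAt (fun T => σ * jetVelocity T 0) T₀ :=
      continuousAt_const.mul (continuousAt_pi.1 cv.continuousAt 0)
    refine (hc.eventually (lt_mem_nhds (a := |jetVelocity T₀ 0| / 2) ?_)).mono fun _ h => h.le
    change _ < σ * jetVelocity T₀ 0
    rw [hσv]; linarith
  have eA := bdd _ (cA.dotProduct cA) M (by simp only [hM]; linarith)
  have eB := bdd _ (cB.dotProduct cB) M (by simp only [hM]; linarith)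
  have evv := bdd _ (cv.dotProduct cv) M (by simp only [hM]; linarith)
  have sV := small _ pV (by simp [jetCoeffV, hj]) ε hε
  have sA := small _ pA (by simp [jetCoeffA, hj]) ε hε
  have sB := small _ pB (by simp [jetCoeffB, hj]) ε hε
  obtain ⟨δ, hδ, hall⟩ := Metric.eventually_nhds_iff.1
    (ev.and (eA.and (eB.and (evv.and (sV.and (sA.and (sB.and (e₁.and (e₂.and e₃)))))))))
  refine ⟨min δ (min r₁ (min r₂ r₃)), by positivity, fun T hT => ?_⟩
  rw [← dist_eq_norm] at hT
  obtain ⟨k1, k2, k3, k4, k5, k6, k7, k8, k9, k10⟩ := hall (hT.trans_le (min_le_left _ _))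
  refine ⟨k1, k2, k3, k4, k5, k6, k7, fun D hD => ?_⟩
  simp only [lt_min_iff] at hD
  exact ⟨k8 D hD.2.1, k9 D hD.2.2.1, k10 D hD.2.2.2⟩

/-! ### The lower-order term -/

section Hamiltonian

variable {H₀ : (Fin 2 → ℝ) → ℝ} {w₁ w₂ : Fin 2 → ℝ} {η : ℝ}

/-- Periodicity propagates the bound on the second derivative from the parallelogram to the
plane. -/
lemma norm_iteratedFDeriv_le_of_supNormSecondDeriv_lt
    (hspan : ∀ q : Fin 2 → ℝ, ∃ s t : ℝ, q = s • w₁ + t • w₂)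
    (h₁ : ∀ q, H₀ (q + w₁) = H₀ q) (h₂ : ∀ q, H₀ (q + w₂) = H₀ q) (hη : 0 < η)
    (h : supNormSecondDeriv (closedParallelogram w₁ w₂) H₀ < ENNReal.ofReal η) (q : Fin 2 → ℝ) :
    ‖iteratedFDeriv ℝ 2 H₀ q‖ ≤ η := by
  have per : ∀ w, (∀ q, H₀ (q + w) = H₀ q) → Function.Periodic (iteratedFDeriv ℝ 2 H₀) w := by
    intro w hw q
    rw [← iteratedFDeriv_comp_add_right]
    exact congrArg (fun φ => iteratedFDeriv ℝ 2 φ q) (funext hw)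
  obtain ⟨s, t, rfl⟩ := hspan q
  obtain ⟨n, hn⟩ := exists_int_translate_mem_Icc one_pos s
  obtain ⟨m, hm⟩ := exists_int_translate_mem_Icc one_pos t
  rw [mul_one] at hn hm
  have e : iteratedFDeriv ℝ 2 H₀ ((s + n) • w₁ + (t + m) • w₂)
      = iteratedFDeriv ℝ 2 H₀ (s • w₁ + t • w₂) := by
    have e' : (s + n) • w₁ + (t + m) • w₂ = s • w₁ + t • w₂ + n • w₁ + m • w₂ := by
      simp only [add_smul, Int.cast_smul_eq_zsmul]
      abel
    rw [e', (per w₂ h₂).zsmul m, (per w₁ h₁).zsmul n]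
  rw [← e]
  have hle : ‖iteratedFDeriv ℝ 2 H₀ ((s + n) • w₁ + (t + m) • w₂)‖ₑ ≤ ENNReal.ofReal η :=
    (le_iSup₂ (f := fun q (_ : q ∈ closedParallelogram w₁ w₂) => ‖iteratedFDeriv ℝ 2 H₀ q‖ₑ) _
      ⟨_, hn, _, hm, rfl⟩).trans h.le
  rwa [← ofReal_norm, ENNReal.ofReal_le_ofReal_iff hη.le] at hle

lemma norm_vec_two_sq_le (x y : ℝ) : ‖![x, y]‖ ^ 2 ≤ x ^ 2 + y ^ 2 := by
  have : ‖![x, y]‖ ≤ √(x ^ 2 + y ^ 2) := by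
    refine (pi_norm_le_iff_of_nonneg (Real.sqrt_nonneg _)).2 fun i => ?_
    fin_cases i
    · exact Real.abs_le_sqrt (by simpa using sq_nonneg y)
    · exact Real.abs_le_sqrt (by simpa using sq_nonneg x)
  calc _ ≤ √(x ^ 2 + y ^ 2) ^ 2 := by gcongr
    _ = _ := Real.sq_sqrt (by positivity)

lemma fderiv_difference_ge (hH₀ : ContDiff ℝ 2 H₀) (h : ∀ q, ‖iteratedFDeriv ℝ 2 H₀ q‖ ≤ η)
    (x y x' y' : ℝ) :
    -(η * ((x - x') ^ 2 + (y - y') ^ 2))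
      ≤ (fderiv ℝ H₀ ![x, y] - fderiv ℝ H₀ ![x', y']) ![x - x', y - y'] := by
  have hd : Differentiable ℝ (fderiv ℝ H₀) :=
    (hH₀.fderiv_right (m := 1) (by norm_num)).differentiable (by norm_num)
  have hb : ∀ q ∈ univ, ‖fderiv ℝ (fderiv ℝ H₀) q‖ ≤ η := by
    intro q _
    rw [← norm_iteratedFDeriv_one, norm_iteratedFDeriv_fderiv]
    exact h q
  have hη : 0 ≤ η := (norm_nonneg _).trans (h 0)
  have e : ![x, y] - ![x', y'] = ![x - x', y - y'] := by ext i; fin_cases i <;> simp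
  have hm := convex_univ.norm_image_sub_le_of_norm_fderiv_le (fun q _ => hd q) hb
    (mem_univ ![x', y']) (mem_univ ![x, y])
  rw [e] at hm
  have habs := (fderiv ℝ H₀ ![x, y] - fderiv ℝ H₀ ![x', y']).le_opNorm ![x - x', y - y']
  have h1 := mul_le_mul_of_nonneg_right hm (norm_nonneg ![x - x', y - y'])
  have h2 := mul_le_mul_of_nonneg_left (norm_vec_two_sq_le (x - x') (y - y')) hη
  have h3 := neg_abs_le ((fderiv ℝ H₀ ![x, y] - fderiv ℝ H₀ ![x', y']) ![x - x', y - y'])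
  rw [Real.norm_eq_abs] at habs
  nlinarith

lemma fderiv_affine_add {H : (Fin 2 → ℝ) → ℝ} {c₁ c₂ : ℝ} (hH₀ : Differentiable ℝ H₀)
    (hH : ∀ q, H q = c₁ * q 0 + c₂ * q 1 + H₀ q) (q w : Fin 2 → ℝ) :
    fderiv ℝ H q w = c₁ * w 0 + c₂ * w 1 + fderiv ℝ H₀ q w := by
  have h := ((((hasFDerivAt_apply (𝕜 := ℝ) (0 : Fin 2) q).const_mul c₁).add
    ((hasFDerivAt_apply (𝕜 := ℝ) (1 : Fin 2) q).const_mul c₂)).add (hH₀ q).hasFDerivAt)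
  have e : H = fun q => c₁ * q 0 + c₂ * q 1 + H₀ q := funext hH
  rw [e]
  erw [h.fderiv]
  simp

lemma clm_vec_two (l : (Fin 2 → ℝ) →L[ℝ] ℝ) (x y : ℝ) :
    l ![x, y] = x * l (Pi.single 0 1) + y * l (Pi.single 1 1) := by
  have : ![x, y] = x • (Pi.single 0 1 : Fin 2 → ℝ) + y • (Pi.single 1 1 : Fin 2 → ℝ) := by
    ext i; fin_cases i <;> simp
  rw [this, map_add, map_smul, map_smul, smul_eq_mul, smul_eq_mul]

end Hamiltonian

/-! ### Jets of pairs of gradients -/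

/-- The pair `(∇f, ∇g)`. -/
noncomputable def gradPair (L : ℝ) (f g : (Fin 3 → ℝ) → ℝ) (p : Fin 3 → ℝ) : GradPair :=
  (layerGrad L f p, layerGrad L g p)

section Jets

variable {L P₁ P₂ δ : ℝ} {f g fbar gbar : (Fin 3 → ℝ) → ℝ} {a b : Fin 3 → ℝ}

lemma contDiffOn_gradPair (hL : 0 < L) (hf : ContDiffOn ℝ 3 f (closedLayer L))
    (hg : ContDiffOn ℝ 3 g (closedLayer L)) :
    ContDiffOn ℝ 2 (gradPair L f g) (closedLayer L) :=
  (contDiffOn_layerGrad (n := 2) hL (by exact_mod_cast hf)).prodMk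
    (contDiffOn_layerGrad (n := 2) hL (by exact_mod_cast hg))

lemma contDiffOn_layerJet (hL : 0 < L) {u : (Fin 3 → ℝ) → GradPair}
    (hu : ContDiffOn ℝ 2 u (closedLayer L)) :
    ContDiffOn ℝ 1 (layerJet L u) (closedLayer L) :=
  (hu.of_le (by norm_num)).prodMk
    (hu.fderivWithin (uniqueDiffOn_closedLayer hL) (by norm_num))

lemma LayerPeriodic.layerJet {u : (Fin 3 → ℝ) → GradPair} (hu : LayerPeriodic L P₁ P₂ u) :
    LayerPeriodic L P₁ P₂ (layerJet L u) :=
  hu.prodMk hu.fderivWithin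

lemma fderivWithin_layerJet (hL : 0 < L) {p : Fin 3 → ℝ} (hp : p ∈ closedLayer L)
    {u : (Fin 3 → ℝ) → GradPair} (hu : ContDiffOn ℝ 2 u (closedLayer L)) :
    fderivWithin ℝ (layerJet L u) (closedLayer L) p
      = (fderivWithin ℝ u (closedLayer L) p).prod
          (fderivWithin ℝ (fderivWithin ℝ u (closedLayer L)) (closedLayer L) p) := by
  have hU := uniqueDiffOn_closedLayer hL
  have h1 := hu.differentiableOn (by norm_num) p hp
  have h2 := (hu.fderivWithin (m := 1) hU (by norm_num)).differentiableOn (by norm_num) p hp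
  exact h1.fderivWithin_prodMk h2 (hU p hp)

/-- The `C²` distance of `(∇f, ∇g)` to the constant pair `(a, b)` controls the first-order jet of
`(∇f, ∇g)` in `C¹`. -/
lemma layerJet_bounds_of_gradC2Dist_lt (hL : 0 < L)
    (hf : ContDiffOn ℝ 3 f (closedLayer L)) (hg : ContDiffOn ℝ 3 g (closedLayer L))
    (ha : ∀ p ∈ closedLayer L, layerGrad L fbar p = a)
    (hb : ∀ p ∈ closedLayer L, layerGrad L gbar p = b)
    (h : gradC2Dist L P₁ P₂ f g fbar gbar < ENNReal.ofReal δ) {p : Fin 3 → ℝ}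
    (hp : p ∈ closedCell L P₁ P₂) :
    ‖layerJet L (gradPair L f g) p - ((a, b), 0)‖ < δ ∧
      ‖fderivWithin ℝ (layerJet L (gradPair L f g)) (closedLayer L) p‖ < δ := by
  have hU := uniqueDiffOn_closedLayer hL
  have hpl := closedCell_subset_closedLayer L P₁ P₂ hp
  have hk : ∀ k ∈ Finset.range 3,
      ‖iteratedFDerivWithin ℝ k (fun q => gradPair L f g q - (a, b)) (closedLayer L) p‖ < δ := by
    intro k hk
    have hcongr : EqOn (fun q => (layerGrad L f q - layerGrad L fbar q,
        layerGrad L g q - layerGrad L gbar q)) (fun q => gradPair L f g q - (a, b))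
        (closedLayer L) := fun q hq => by simp [gradPair, ha q hq, hb q hq]
    rw [← iteratedFDerivWithin_congr hcongr hpl k]
    have h1 := le_iSup₂ (f := fun q (_ : q ∈ closedCell L P₁ P₂) =>
      ‖iteratedFDerivWithin ℝ k (fun q => (layerGrad L f q - layerGrad L fbar q,
        layerGrad L g q - layerGrad L gbar q)) (closedLayer L) q‖ₑ) p hp
    have h2 := h1.trans (Finset.single_le_sum (f := fun k => ⨆ q ∈ closedCell L P₁ P₂,
      ‖iteratedFDerivWithin ℝ k (fun q => (layerGrad L f q - layerGrad L fbar q,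
        layerGrad L g q - layerGrad L gbar q)) (closedLayer L) q‖ₑ) (fun _ _ => zero_le) hk)
    have h3 := h2.trans_lt h
    rw [← ofReal_norm] at h3
    exact (ENNReal.ofReal_lt_ofReal_iff_of_nonneg (norm_nonneg _)).1 h3
  have hD : fderivWithin ℝ (fun q => gradPair L f g q - (a, b)) (closedLayer L)
      = fderivWithin ℝ (gradPair L f g) (closedLayer L) :=
    funext fun q => fderivWithin_sub_const _
  have h0 := hk 0 (by decide)
  have h1 := hk 1 (by decide)
  have h2 := hk 2 (by decide)
  rw [norm_iteratedFDerivWithin_zero] at h0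
  rw [norm_iteratedFDerivWithin_one _ (hU p hpl), hD] at h1
  rw [← norm_iteratedFDerivWithin_fderivWithin (n := 1) hU hpl,
    norm_iteratedFDerivWithin_one _ (hU p hpl), hD] at h2
  constructor
  · rw [layerJet, Prod.mk_sub_mk, sub_zero, Prod.norm_mk]
    exact max_lt h0 h1
  · rw [fderivWithin_layerJet hL hpl (contDiffOn_gradPair hL hf hg),
      ContinuousLinearMap.opNorm_prod, Prod.norm_mk]
    exact max_lt h1 h2

lemma norm_midpoint_lt {E : Type*} [SeminormedAddCommGroup E] [NormedSpace ℝ E] {x y : E}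
    (hx : ‖x‖ < δ) (hy : ‖y‖ < δ) : ‖(1 / 2 : ℝ) • (x + y)‖ < δ := by
  rw [norm_smul, Real.norm_of_nonneg (by norm_num)]
  linarith [norm_add_le x y]

lemma fderivWithin_midpoint {E E' : Type*} [NormedAddCommGroup E] [NormedSpace ℝ E]
    [NormedAddCommGroup E'] [NormedSpace ℝ E'] {s : Set E} (hs : UniqueDiffOn ℝ s) {u w w' : E → E'}
    (hu : EqOn u (fun q => (1 / 2 : ℝ) • (w q + w' q)) s) {p : E} (hp : p ∈ s)
    (hw : DifferentiableWithinAt ℝ w s p) (hw' : DifferentiableWithinAt ℝ w' s p) :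
    fderivWithin ℝ u s p = (1 / 2 : ℝ) • (fderivWithin ℝ w s p + fderivWithin ℝ w' s p) := by
  rw [fderivWithin_congr hu (hu hp)]
  exact ((hw.hasFDerivWithinAt.add hw'.hasFDerivWithinAt).const_smul (1 / 2 : ℝ)).fderivWithin
    (hs p hp)

/-- The bounds on jets pass to midpoints. -/
lemma layerJet_bounds_midpoint (hL : 0 < L) {u w w' : (Fin 3 → ℝ) → GradPair}
    (hu : EqOn u (fun q => (1 / 2 : ℝ) • (w q + w' q)) (closedLayer L))
    (hw : ContDiffOn ℝ 2 w (closedLayer L)) (hw' : ContDiffOn ℝ 2 w' (closedLayer L))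
    {p : Fin 3 → ℝ} (hp : p ∈ closedLayer L) {T₀ : GradJet}
    (h : ‖layerJet L w p - T₀‖ < δ ∧ ‖fderivWithin ℝ (layerJet L w) (closedLayer L) p‖ < δ)
    (h' : ‖layerJet L w' p - T₀‖ < δ ∧ ‖fderivWithin ℝ (layerJet L w') (closedLayer L) p‖ < δ) :
    ‖layerJet L u p - T₀‖ < δ ∧ ‖fderivWithin ℝ (layerJet L u) (closedLayer L) p‖ < δ := by
  have hU := uniqueDiffOn_closedLayer hL
  have hjet : EqOn (layerJet L u) (fun q => (1 / 2 : ℝ) • (layerJet L w q + layerJet L w' q))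
      (closedLayer L) := by
    intro q hq
    have := fderivWithin_midpoint hU hu hq (hw.differentiableOn (by norm_num) q hq)
      (hw'.differentiableOn (by norm_num) q hq)
    exact Prod.ext (hu hq) this
  constructor
  · have e : layerJet L u p - T₀
        = (1 / 2 : ℝ) • ((layerJet L w p - T₀) + (layerJet L w' p - T₀)) := by
      rw [hjet hp]
      module
    rw [e]
    exact norm_midpoint_lt h.1 h'.1
  · rw [fderivWithin_midpoint hU hjet hp
      ((contDiffOn_layerJet hL hw).differentiableOn (by norm_num) p hp)
      ((contDiffOn_layerJet hL hw').differentiableOn (by norm_num) p hp)]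
    exact norm_midpoint_lt (E := (Fin 3 → ℝ) →L[ℝ] GradJet) h.2 h'.2

end Jets

/-! ### The coercive field -/

/-- `u` is differentiable at `p` within the closed layer and has divergence `d` there. -/
def HasLayerDiv (L : ℝ) (u : (Fin 3 → ℝ) → (Fin 3 → ℝ)) (d : ℝ) (p : Fin 3 → ℝ) : Prop :=
  DifferentiableWithinAt ℝ u (closedLayer L) p ∧ layerDiv L u p = d

namespace HasLayerDiv

variable {L d e : ℝ} {p : Fin 3 → ℝ} {u w : (Fin 3 → ℝ) → (Fin 3 → ℝ)}

lemma add (hL : 0 < L) (hp : p ∈ closedLayer L) (hu : HasLayerDiv L u d p)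
    (hw : HasLayerDiv L w e p) : HasLayerDiv L (fun q => u q + w q) (d + e) p :=
  ⟨hu.1.add hw.1, by rw [layerDiv_add hL hp hu.1 hw.1, hu.2, hw.2]⟩

lemma sub (hL : 0 < L) (hp : p ∈ closedLayer L) (hu : HasLayerDiv L u d p)
    (hw : HasLayerDiv L w e p) : HasLayerDiv L (fun q => u q - w q) (d - e) p :=
  ⟨hu.1.sub hw.1, by rw [layerDiv_sub hL hp hu.1 hw.1, hu.2, hw.2]⟩

lemma smul (hL : 0 < L) (hp : p ∈ closedLayer L) {φ : (Fin 3 → ℝ) → ℝ}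
    (hφ : DifferentiableWithinAt ℝ φ (closedLayer L) p) (hu : HasLayerDiv L u d p) :
    HasLayerDiv L (fun q => φ q • u q) (layerGrad L φ p ⬝ᵥ u p + φ p * d) p :=
  ⟨hφ.smul hu.1, by rw [layerDiv_smul hL hp hφ hu.1, hu.2]⟩

end HasLayerDiv

/-- The field whose divergence is coercive in `(F, G)`. The first two terms reproduce the
Euler–Lagrange equations tested with `(F, G)`, the third one integrates the term `v · (∇F × ∇G)` by
parts, the next three remove the transverse derivatives of `F` and `G` that are left over, and the
last one yields a Poincaré inequality along the streamlines of `v`. -/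
noncomputable def coercivityField (L μ : ℝ) (u : (Fin 3 → ℝ) → GradPair) (F G : (Fin 3 → ℝ) → ℝ)
    (E₁ E₂ : (Fin 3 → ℝ) → (Fin 3 → ℝ)) (q : Fin 3 → ℝ) : Fin 3 → ℝ :=
  F q • E₁ q + G q • E₂ q
    - (2 * F q) • (layerGrad L G q ⨯₃ jetVelocity (layerJet L u q))
    + (F q * F q) • (jetCoeffB (layerJet L u q) • jetFrameA (layerJet L u q))
    - (2 * (F q * G q)) • (jetCoeffA (layerJet L u q) • jetFrameA (layerJet L u q))
    - (G q * G q) • (jetCoeffA (layerJet L u q) • jetFrameB (layerJet L u q))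
    + (μ * (q 0 * (F q * F q + G q * G q))) • jetVelocity (layerJet L u q)

section Divergence

variable {L : ℝ} {p : Fin 3 → ℝ}

lemma layerGrad_const_mul (hL : 0 < L) (hp : p ∈ closedLayer L) {φ : (Fin 3 → ℝ) → ℝ} (c : ℝ)
    (hφ : DifferentiableWithinAt ℝ φ (closedLayer L) p) :
    layerGrad L (fun q => c * φ q) p = c • layerGrad L φ p := by
  funext i
  rw [layerGrad,
    (hφ.hasFDerivWithinAt.const_mul c).fderivWithin (uniqueDiffOn_closedLayer hL p hp)]
  rfl

lemma layerGrad_coord (hL : 0 < L) (hp : p ∈ closedLayer L) :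
    layerGrad L (fun q => q 0) p = Pi.single 0 1 := by
  funext i
  have h := (hasFDerivAt_apply (𝕜 := ℝ) (0 : Fin 3) p).hasFDerivWithinAt (s := closedLayer L)
  rw [layerGrad, h.fderivWithin (uniqueDiffOn_closedLayer hL p hp)]
  fin_cases i <;> simp

lemma layerDiv_coercivityField (hL : 0 < L) (hp : p ∈ closedLayer L) (μ : ℝ)
    {u : (Fin 3 → ℝ) → GradPair} {F G : (Fin 3 → ℝ) → ℝ} {E₁ E₂ : (Fin 3 → ℝ) → (Fin 3 → ℝ)}
    (hu : DifferentiableWithinAt ℝ u (closedLayer L) p)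
    (hT : DifferentiableWithinAt ℝ (layerJet L u) (closedLayer L) p)
    (hv : jetVelocity (layerJet L u p) ⬝ᵥ jetVelocity (layerJet L u p) ≠ 0)
    (hdiv : layerDiv L (fun q => jetVelocity (layerJet L u q)) p = 0)
    (hF : DifferentiableWithinAt ℝ F (closedLayer L) p) (hG : ContDiffOn ℝ 2 G (closedLayer L))
    (hE₁ : DifferentiableWithinAt ℝ E₁ (closedLayer L) p)
    (hE₂ : DifferentiableWithinAt ℝ E₂ (closedLayer L) p)
    {T : GradJet} (hTp : T = layerJet L u p) {v φ γ : Fin 3 → ℝ} (hvp : v = jetVelocity T)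
    (hφ : φ = layerGrad L F p) (hγ : γ = layerGrad L G p) {d₁ d₂ d₃ : ℝ}
    (hd₁ : d₁ = layerDiv L (fun q =>
      jetCoeffB (layerJet L u q) • jetFrameA (layerJet L u q)) p)
    (hd₂ : d₂ = layerDiv L (fun q =>
      jetCoeffA (layerJet L u q) • jetFrameA (layerJet L u q)) p)
    (hd₃ : d₃ = layerDiv L (fun q =>
      jetCoeffA (layerJet L u q) • jetFrameB (layerJet L u q)) p) :
    layerDiv L (coercivityField L μ u F G E₁ E₂) p
      = φ ⬝ᵥ E₁ p + γ ⬝ᵥ E₂ p - 2 * (φ ⬝ᵥ γ ⨯₃ v)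
        + (F p * layerDiv L E₁ p + G p * layerDiv L E₂ p)
        + 2 * jetCoeffV T * F p * (v ⬝ᵥ γ)
        + 2 * jetCoeffB T * F p * (jetFrameA T ⬝ᵥ φ + jetFrameB T ⬝ᵥ γ)
        - 2 * jetCoeffA T * G p * (jetFrameA T ⬝ᵥ φ + jetFrameB T ⬝ᵥ γ)
        + F p ^ 2 * d₁ - 2 * (F p * G p) * d₂ - G p ^ 2 * d₃
        + μ * (v 0 * (F p ^ 2 + G p ^ 2) + 2 * p 0 * (F p * (v ⬝ᵥ φ) + G p * (v ⬝ᵥ γ))) := by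
  have hv' : DifferentiableAt ℝ jetVelocity (layerJet L u p) :=
    (contDiffAt_jetVelocity (n := 1)).differentiableAt (by norm_num)
  have dA := (contDiffAt_jetCoeffA (n := 1) hv).differentiableAt (by norm_num)
  have dB := (contDiffAt_jetCoeffB (n := 1) hv).differentiableAt (by norm_num)
  have dFA : DifferentiableAt ℝ jetFrameA (layerJet L u p) :=
    (contDiffAt_jetFrameA (n := 1)).differentiableAt (by norm_num)
  have dFB : DifferentiableAt ℝ jetFrameB (layerJet L u p) :=
    (contDiffAt_jetFrameB (n := 1)).differentiableAt (by norm_num)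
  have hvd : DifferentiableWithinAt ℝ (fun q => jetVelocity (layerJet L u q)) (closedLayer L) p :=
    hv'.comp_differentiableWithinAt p hT
  have hG1 : DifferentiableWithinAt ℝ G (closedLayer L) p :=
    hG.differentiableOn (by norm_num) p hp
  have hGg : ContDiffOn ℝ 1 (layerGrad L G) (closedLayer L) :=
    contDiffOn_layerGrad (n := 1) hL (by exact_mod_cast hG)
  have hGgd := hGg.differentiableOn (by norm_num) p hp
  have hX : HasLayerDiv L (fun q => layerGrad L G q ⨯₃ jetVelocity (layerJet L u q))
      (-(γ ⬝ᵥ jetVorticity T)) p := by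
    refine ⟨?_, ?_⟩
    · have h1 := differentiableWithinAt_pi.1 hGgd
      have h2 := differentiableWithinAt_pi.1 hvd
      refine differentiableWithinAt_pi.2 fun i => ?_
      fin_cases i
      · exact ((h1 1).mul (h2 2)).sub ((h1 2).mul (h2 1))
      · exact ((h1 2).mul (h2 0)).sub ((h1 0).mul (h2 2))
      · exact ((h1 0).mul (h2 1)).sub ((h1 1).mul (h2 0))
    · rw [layerDiv_cross hL hp hGgd hvd, layerCurl_layerGrad hL hp hG,
        layerCurl_jetVelocity hL hp hu, hγ, hTp]
      simp
  have hY₁ : HasLayerDiv L (fun q => jetCoeffB (layerJet L u q) • jetFrameA (layerJet L u q))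
      d₁ p := ⟨(dB.smul dFA).comp_differentiableWithinAt p hT, hd₁.symm⟩
  have hY₂ : HasLayerDiv L (fun q => jetCoeffA (layerJet L u q) • jetFrameA (layerJet L u q))
      d₂ p := ⟨(dA.smul dFA).comp_differentiableWithinAt p hT, hd₂.symm⟩
  have hY₃ : HasLayerDiv L (fun q => jetCoeffA (layerJet L u q) • jetFrameB (layerJet L u q))
      d₃ p := ⟨(dA.smul dFB).comp_differentiableWithinAt p hT, hd₃.symm⟩
  have hx : DifferentiableWithinAt ℝ (fun q : Fin 3 → ℝ => q 0) (closedLayer L) p :=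
    (differentiableAt_apply 0 p).differentiableWithinAt
  have hFF := hF.fun_mul hF
  have hFG := hF.fun_mul hG1
  have hGG := hG1.fun_mul hG1
  have hS := hFF.fun_add hGG
  have hxS := hx.fun_mul hS
  have key := ((((((HasLayerDiv.smul hL hp hF ⟨hE₁, rfl⟩).add hL hp
    (HasLayerDiv.smul hL hp hG1 ⟨hE₂, rfl⟩)).sub hL hp
    (HasLayerDiv.smul hL hp (hF.const_mul 2) hX)).add hL hp
    (HasLayerDiv.smul hL hp hFF hY₁)).sub hL hp
    (HasLayerDiv.smul hL hp (hFG.const_mul 2) hY₂)).sub hL hp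
    (HasLayerDiv.smul hL hp hGG hY₃)).add hL hp
    (HasLayerDiv.smul hL hp (hxS.const_mul μ) ⟨hvd, hdiv⟩)
  refine key.2.trans ?_
  rw [layerGrad_const_mul hL hp 2 hF, layerGrad_const_mul hL hp 2 hFG,
    layerGrad_const_mul hL hp μ hxS, layerGrad_mul hL hp hx hS, layerGrad_add hL hp hFF hGG,
    layerGrad_mul hL hp hF hF, layerGrad_mul hL hp hF hG1, layerGrad_mul hL hp hG1 hG1,
    layerGrad_coord hL hp, ← hφ, ← hγ, ← hTp, ← hvp]
  -- the remaining term `2 F ∇G · j` of the integration by parts, expanded in the frame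
  have hj : γ ⬝ᵥ jetVorticity T = jetCoeffV T * (v ⬝ᵥ γ) + jetCoeffA T * (jetFrameA T ⬝ᵥ γ)
      + jetCoeffB T * (jetFrameB T ⬝ᵥ γ) := by
    rw [← hTp] at hv
    have h := velocity_frame_expansion T.1.1 T.1.2 (jetVorticity T) γ
    change (jetVelocity T ⬝ᵥ jetVelocity T) * _ = (jetVelocity T ⬝ᵥ _) * (jetVelocity T ⬝ᵥ γ)
      + _ * (jetFrameA T ⬝ᵥ γ) + _ * (jetFrameB T ⬝ᵥ γ) at h
    rw [hvp, jetCoeffV, jetCoeffA, jetCoeffB]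
    field_simp
    linear_combination h
  rw [hj]
  simp only [add_dotProduct, smul_dotProduct, dotProduct_smul, smul_eq_mul, single_dotProduct,
    dotProduct_comm φ (jetFrameA T), dotProduct_comm γ (jetFrameA T),
    dotProduct_comm γ (jetFrameB T), dotProduct_comm φ v, dotProduct_comm γ v]
  ring

end Divergence

/-! ### Uniqueness -/

section Uniqueness

variable {L P₁ P₂ : ℝ}

/-- A nonnegative function bounded by the divergence of a periodic field that vanishes on the two
boundary planes is zero. -/
lemma eq_zero_of_le_layerDiv (hL : 0 < L) (hP₁ : 0 < P₁) (hP₂ : 0 < P₂)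
    {U : (Fin 3 → ℝ) → (Fin 3 → ℝ)} (hU : ContDiffOn ℝ 1 U (closedLayer L))
    (hper : LayerPeriodic L P₁ P₂ U) (h0 : ∀ p, p 0 = 0 ∨ p 0 = L → U p = 0)
    {φ : (Fin 3 → ℝ) → ℝ} (hφ : ContinuousOn φ (closedLayer L)) (hφ0 : ∀ p, 0 ≤ φ p)
    (hle : ∀ p ∈ closedCell L P₁ P₂, p ∈ openLayer L → φ p ≤ layerDiv L U p)
    {p : Fin 3 → ℝ} (hp : p ∈ closedCell L P₁ P₂) : φ p = 0 := by
  set P : Fin 3 → ℝ := ![L, P₁, P₂] with hPdef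
  have hP : ∀ i, (0 : Fin 3 → ℝ) i ≠ P i := by
    intro i; fin_cases i <;> simp [hPdef, hL.ne, hP₁.ne, hP₂.ne]
  set s : Set (Fin 3 → ℝ) := Set.pi univ fun i => Ioo ((0 : Fin 3 → ℝ) i) (P i) with hs
  have hso : IsOpen s := isOpen_set_pi finite_univ fun _ _ => isOpen_Ioo
  have hcl : closure s = closedCell L P₁ P₂ := by
    rw [hs, closure_pi_set, eq_Icc_closedCell, ← pi_univ_Icc]
    simp only [closure_Ioo (hP _)]
    rfl
  have hcell := closedCell_subset_closedLayer L P₁ P₂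
  have hsc : s ⊆ closedCell L P₁ P₂ := hcl ▸ subset_closure
  have hae : s =ᵐ[MeasureTheory.volume] closedCell L P₁ P₂ := by
    rw [eq_Icc_closedCell]
    exact MeasureTheory.Measure.univ_pi_Ioo_ae_eq_Icc
  have hcomp : IsCompact (closedCell L P₁ P₂) := eq_Icc_closedCell L P₁ P₂ ▸ isCompact_Icc
  have hint : ∀ ψ : (Fin 3 → ℝ) → ℝ, ContinuousOn ψ (closedLayer L) →
      MeasureTheory.IntegrableOn ψ s := fun ψ hψ =>
    ((hψ.mono hcell).integrableOn_compact hcomp).mono_set hsc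
  have hdiv : ∫ q in s, layerDiv L U q = 0 := by
    rw [MeasureTheory.setIntegral_congr_set hae]
    exact integral_layerDiv_eq_zero hL hP₁ hP₂ hU hper h0
  have hφle : ∫ q in s, φ q ≤ 0 := by
    rw [← hdiv]
    refine MeasureTheory.setIntegral_mono_on (hint _ hφ) (hint _ (hU.continuousOn_layerDiv hL))
      hso.measurableSet fun q hq => hle q (hsc hq) ?_
    exact hq 0 (mem_univ _)
  have hφz : ∫ q in s, φ q = 0 := hφle.antisymm (MeasureTheory.integral_nonneg hφ0)
  have hz := (MeasureTheory.setIntegral_eq_zero_iff_of_nonneg_ae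
    (Filter.Eventually.of_forall hφ0) (hint _ hφ)).1 hφz
  have heq : EqOn φ 0 s := MeasureTheory.Measure.eqOn_open_of_ae_eq hz hso
    (hφ.mono (hsc.trans hcell)) continuousOn_const
  exact heq.of_subset_closure (hφ.mono hcell) continuousOn_const hsc hcl.ge hp

lemma fderivWithin_eq_of_layerGrad_eq {φ ψ : (Fin 3 → ℝ) → ℝ} {p q : Fin 3 → ℝ}
    (h : layerGrad L φ p = layerGrad L ψ q) :
    fderivWithin ℝ φ (closedLayer L) p = fderivWithin ℝ ψ (closedLayer L) q :=
  ContinuousLinearMap.coe_injective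
    (LinearMap.pi_ext' fun i => LinearMap.ext_ring (by simpa [layerGrad] using congrFun h i))

open scoped Pointwise in
/-- A function with periodic gradient that vanishes on the plane `x = 0` is itself periodic. -/
lemma add_single_eq_of_layerGrad_periodic (hL : 0 < L) {φ : (Fin 3 → ℝ) → ℝ}
    (hφ : DifferentiableOn ℝ φ (closedLayer L)) {i : Fin 3} (hi : i ≠ 0) {P : ℝ}
    (h : ∀ p ∈ closedLayer L, layerGrad L φ (p + Pi.single i P) = layerGrad L φ p)
    (h0 : ∀ p : Fin 3 → ℝ, p 0 = 0 → φ p = 0) {p : Fin 3 → ℝ} (hp : p ∈ closedLayer L) :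
    φ (p + Pi.single i P) = φ p := by
  have hU := uniqueDiffOn_closedLayer hL
  have htr : MapsTo (fun q => q + Pi.single i P) (closedLayer L) (closedLayer L) :=
    fun q hq => (add_single_mem_closedLayer hi P).2 hq
  have hd : ∀ q ∈ closedLayer L, HasFDerivWithinAt (fun q => φ (q + Pi.single i P) - φ q)
      (0 : (Fin 3 → ℝ) →L[ℝ] ℝ) (closedLayer L) q := by
    intro q hq
    have hid : HasFDerivWithinAt (fun q : Fin 3 → ℝ => q + Pi.single i P)
        (ContinuousLinearMap.id ℝ (Fin 3 → ℝ)) (closedLayer L) q :=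
      (hasFDerivWithinAt_id q (closedLayer L)).add_const _
    have h1 := (hφ _ (htr hq)).hasFDerivWithinAt.comp q hid htr
    have h2 := h1.sub (hφ q hq).hasFDerivWithinAt
    rw [fderivWithin_eq_of_layerGrad_eq (h q hq), ContinuousLinearMap.comp_id, sub_self] at h2
    exact h2
  have hp₀ : Function.update p 0 0 ∈ closedLayer L := by
    simp [mem_closedLayer, hL.le]
  have hc := (convex_closedLayer L).is_const_of_fderivWithin_eq_zero (𝕜 := ℝ)
    (fun q hq => (hd q hq).differentiableWithinAt)
    (fun q hq => (hd q hq).fderivWithin (hU q hq)) hp hp₀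
  have e₁ : φ (Function.update p 0 0) = 0 := h0 _ (by simp)
  have e₂ : φ (Function.update p 0 0 + Pi.single i P) = 0 :=
    h0 _ (by simp [Pi.single_eq_of_ne' hi])
  rw [e₁, e₂, sub_self] at hc
  exact sub_eq_zero.1 hc

lemma contDiffOn_coercivityField (hL : 0 < L) (μ : ℝ) {u : (Fin 3 → ℝ) → GradPair}
    {F G : (Fin 3 → ℝ) → ℝ} {E₁ E₂ : (Fin 3 → ℝ) → (Fin 3 → ℝ)}
    (hu : ContDiffOn ℝ 2 u (closedLayer L))
    (hv : ∀ p ∈ closedLayer L,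
      jetVelocity (layerJet L u p) ⬝ᵥ jetVelocity (layerJet L u p) ≠ 0)
    (hF : ContDiffOn ℝ 2 F (closedLayer L)) (hG : ContDiffOn ℝ 2 G (closedLayer L))
    (hE₁ : ContDiffOn ℝ 1 E₁ (closedLayer L)) (hE₂ : ContDiffOn ℝ 1 E₂ (closedLayer L)) :
    ContDiffOn ℝ 1 (coercivityField L μ u F G E₁ E₂) (closedLayer L) := by
  have hT := contDiffOn_layerJet hL hu
  have hF1 := hF.of_le (m := 1) (by norm_num)
  have hG1 := hG.of_le (m := 1) (by norm_num)
  have hGg : ContDiffOn ℝ 1 (layerGrad L G) (closedLayer L) :=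
    contDiffOn_layerGrad (n := 1) hL (by exact_mod_cast hG)
  have hvel : ContDiffOn ℝ 1 (fun q => jetVelocity (layerJet L u q)) (closedLayer L) :=
    fun p hp => contDiffAt_jetVelocity.comp_contDiffWithinAt p (hT p hp)
  have hA : ContDiffOn ℝ 1 (fun q => jetCoeffA (layerJet L u q)) (closedLayer L) :=
    fun p hp => (contDiffAt_jetCoeffA (hv p hp)).comp_contDiffWithinAt p (hT p hp)
  have hB : ContDiffOn ℝ 1 (fun q => jetCoeffB (layerJet L u q)) (closedLayer L) :=
    fun p hp => (contDiffAt_jetCoeffB (hv p hp)).comp_contDiffWithinAt p (hT p hp)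
  have hFA : ContDiffOn ℝ 1 (fun q => jetFrameA (layerJet L u q)) (closedLayer L) :=
    fun p hp => contDiffAt_jetFrameA.comp_contDiffWithinAt p (hT p hp)
  have hFB : ContDiffOn ℝ 1 (fun q => jetFrameB (layerJet L u q)) (closedLayer L) :=
    fun p hp => contDiffAt_jetFrameB.comp_contDiffWithinAt p (hT p hp)
  have hx : ContDiffOn ℝ 1 (fun q : Fin 3 → ℝ => q 0) (closedLayer L) :=
    (contDiff_apply ℝ ℝ 0).contDiffOn
  exact ((((((hF1.smul hE₁).add (hG1.smul hE₂)).sub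
    ((contDiffOn_const.mul hF1).smul (hGg.cross hvel))).add
    ((hF1.mul hF1).smul (hB.smul hFA))).sub
    ((contDiffOn_const.mul (hF1.mul hG1)).smul (hA.smul hFA))).sub
    ((hG1.mul hG1).smul (hA.smul hFB))).add
    ((contDiffOn_const.mul (hx.mul ((hF1.mul hF1).add (hG1.mul hG1)))).smul hvel)

lemma periodic_coercivityField (μ : ℝ) {u : (Fin 3 → ℝ) → GradPair}
    {F G : (Fin 3 → ℝ) → ℝ} {E₁ E₂ : (Fin 3 → ℝ) → (Fin 3 → ℝ)}
    (hT : LayerPeriodic L P₁ P₂ (layerJet L u))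
    (hF : LayerPeriodic L P₁ P₂ F) (hG : LayerPeriodic L P₁ P₂ G)
    (hGg : LayerPeriodic L P₁ P₂ (layerGrad L G))
    (hE₁ : LayerPeriodic L P₁ P₂ E₁) (hE₂ : LayerPeriodic L P₁ P₂ E₂) :
    LayerPeriodic L P₁ P₂ (coercivityField L μ u F G E₁ E₂) := by
  intro p hp
  constructor
  · simp [coercivityField, (hT p hp).1, (hF p hp).1, (hG p hp).1, (hGg p hp).1, (hE₁ p hp).1,
      (hE₂ p hp).1]
  · simp [coercivityField, (hT p hp).2, (hF p hp).2, (hG p hp).2, (hGg p hp).2, (hE₁ p hp).2,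
      (hE₂ p hp).2]

lemma periodic_of_layerGrad_periodic (hL : 0 < L) {φ : (Fin 3 → ℝ) → ℝ}
    (hφ : DifferentiableOn ℝ φ (closedLayer L)) (h : LayerPeriodic L P₁ P₂ (layerGrad L φ))
    (h0 : ∀ p : Fin 3 → ℝ, p 0 = 0 → φ p = 0) : LayerPeriodic L P₁ P₂ φ :=
  fun _ hp => ⟨add_single_eq_of_layerGrad_periodic hL hφ (by decide) (fun q hq => (h q hq).1) h0 hp,
    add_single_eq_of_layerGrad_periodic hL hφ (by decide) (fun q hq => (h q hq).2) h0 hp⟩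

lemma LayerPeriodic.of_eqOn {E : Type*} {u w : (Fin 3 → ℝ) → E} (hw : LayerPeriodic L P₁ P₂ w)
    (h : EqOn u w (closedLayer L)) : LayerPeriodic L P₁ P₂ u := by
  intro p hp
  have h1 : p + Pi.single 1 P₁ ∈ closedLayer L := (add_single_mem_closedLayer (by decide) _).2 hp
  have h2 : p + Pi.single 2 P₂ ∈ closedLayer L := (add_single_mem_closedLayer (by decide) _).2 hp
  exact ⟨by rw [h h1, h hp, (hw p hp).1], by rw [h h2, h hp, (hw p hp).2]⟩

lemma layerDiv_jetVelocity_gradPair (hL : 0 < L) {m n : (Fin 3 → ℝ) → ℝ}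
    (hm : ContDiffOn ℝ 2 m (closedLayer L)) (hn : ContDiffOn ℝ 2 n (closedLayer L))
    {p : Fin 3 → ℝ} (hp : p ∈ closedLayer L) :
    layerDiv L (fun q => jetVelocity (layerJet L (gradPair L m n) q)) p = 0 := by
  have hm' : ContDiffOn ℝ 1 (layerGrad L m) (closedLayer L) :=
    contDiffOn_layerGrad (n := 1) hL (by exact_mod_cast hm)
  have hn' : ContDiffOn ℝ 1 (layerGrad L n) (closedLayer L) :=
    contDiffOn_layerGrad (n := 1) hL (by exact_mod_cast hn)
  refine (layerDiv_cross hL hp (hm'.differentiableOn (by norm_num) p hp)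
    (hn'.differentiableOn (by norm_num) p hp)).trans ?_
  rw [layerCurl_layerGrad hL hp hm, layerCurl_layerGrad hL hp hn]
  simp

/-- The fluxes `∇g × (∇f × ∇g)` and `(∇f × ∇g) × ∇f` of the two Euler–Lagrange equations. -/
noncomputable def eulerLagrangeFlux (L : ℝ) (f g : (Fin 3 → ℝ) → ℝ) (q : Fin 3 → ℝ) :
    GradPair :=
  (layerGrad L g q ⨯₃ layerVelocity L f g q, layerVelocity L f g q ⨯₃ layerGrad L f q)

lemma contDiffOn_eulerLagrangeFlux (hL : 0 < L) {f g : (Fin 3 → ℝ) → ℝ}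
    (hf : ContDiffOn ℝ 3 f (closedLayer L)) (hg : ContDiffOn ℝ 3 g (closedLayer L)) :
    ContDiffOn ℝ 1 (eulerLagrangeFlux L f g) (closedLayer L) := by
  have hf' : ContDiffOn ℝ 1 (layerGrad L f) (closedLayer L) :=
    contDiffOn_layerGrad (n := 1) hL (by exact_mod_cast hf.of_le (by norm_num))
  have hg' : ContDiffOn ℝ 1 (layerGrad L g) (closedLayer L) :=
    contDiffOn_layerGrad (n := 1) hL (by exact_mod_cast hg.of_le (by norm_num))
  exact (hg'.cross (hf'.cross hg')).prodMk ((hf'.cross hg').cross hf')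

lemma AdmissiblePair.periodic_eulerLagrangeFlux {f g : (Fin 3 → ℝ) → ℝ}
    (h : AdmissiblePair L P₁ P₂ f g) : LayerPeriodic L P₁ P₂ (eulerLagrangeFlux L f g) :=
  (h.periodic_fst.prodMk h.periodic_snd).comp
    fun w => (w.2 ⨯₃ (w.1 ⨯₃ w.2), (w.1 ⨯₃ w.2) ⨯₃ w.1)

/-- Two solutions of the Euler–Lagrange system, tested with their difference. -/
lemma SolvesEulerLagrange.flux_difference_ge {H₀ H : (Fin 2 → ℝ) → ℝ} {c₁ c₂ η : ℝ}
    (hL : 0 < L) (hH₀ : ContDiff ℝ 2 H₀) (hH : ∀ q, H q = c₁ * q 0 + c₂ * q 1 + H₀ q)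
    (hbound : ∀ q, ‖iteratedFDeriv ℝ 2 H₀ q‖ ≤ η) {f g f' g' : (Fin 3 → ℝ) → ℝ}
    (hf : ContDiffOn ℝ 3 f (closedLayer L)) (hg : ContDiffOn ℝ 3 g (closedLayer L))
    (hf' : ContDiffOn ℝ 3 f' (closedLayer L)) (hg' : ContDiffOn ℝ 3 g' (closedLayer L))
    (h : SolvesEulerLagrange L H f g) (h' : SolvesEulerLagrange L H f' g')
    {p : Fin 3 → ℝ} (hp : p ∈ openLayer L) :
    -(η * ((f p - f' p) ^ 2 + (g p - g' p) ^ 2))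
      ≤ (f p - f' p) * layerDiv L
          (fun q => (eulerLagrangeFlux L f g q).1 - (eulerLagrangeFlux L f' g' q).1) p
        + (g p - g' p) * layerDiv L
          (fun q => (eulerLagrangeFlux L f g q).2 - (eulerLagrangeFlux L f' g' q).2) p := by
  have hpc := openLayer_subset_closedLayer L hp
  have d := (contDiffOn_eulerLagrangeFlux hL hf hg).differentiableOn (by norm_num) p hpc
  have d' := (contDiffOn_eulerLagrangeFlux hL hf' hg').differentiableOn (by norm_num) p hpc
  rw [layerDiv_sub hL hpc d.fst d'.fst, layerDiv_sub hL hpc d.snd d'.snd]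
  obtain ⟨e₁, e₂⟩ := h p hp
  obtain ⟨e₁', e₂'⟩ := h' p hp
  have hd := hH₀.differentiable (by norm_num)
  rw [fderiv_affine_add hd hH] at e₁ e₂ e₁' e₂'
  have key := fderiv_difference_ge hH₀ hbound (f p) (g p) (f' p) (g' p)
  rw [clm_vec_two] at key
  simp only [_root_.sub_apply, Pi.single_eq_same, mul_one, ne_eq, one_ne_zero,
    not_false_eq_true, Pi.single_eq_of_ne, zero_ne_one, mul_zero, add_zero, zero_add]
    at key e₁ e₂ e₁' e₂'
  simp only [eulerLagrangeFlux]
  refine key.trans_eq ?_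
  linear_combination (f p - f' p) * (e₁ - e₁') + (g p - g' p) * (e₂ - e₂')

end Uniqueness

/-- The lattice vectors span the plane, since `det R` is the first component of `a × b`. -/
lemma exists_smul_add_smul_eq_of_crossSectionMatrix {P₁ P₂ : ℝ} {a b : Fin 3 → ℝ} (hP₁ : P₁ ≠ 0)
    (hP₂ : P₂ ≠ 0) (hv : (a ⨯₃ b) 0 ≠ 0) {w₁ w₂ : Fin 2 → ℝ}
    (hw₁ : w₁ = crossSectionMatrix a b *ᵥ ![P₁, 0])
    (hw₂ : w₂ = crossSectionMatrix a b *ᵥ ![0, P₂]) (q : Fin 2 → ℝ) :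
    ∃ s t : ℝ, q = s • w₁ + t • w₂ := by
  obtain ⟨d, hd⟩ : ∃ d, a 1 * b 2 - a 2 * b 1 = d := ⟨_, rfl⟩
  have hd0 : d ≠ 0 := by
    rw [← hd]
    simpa [cross_apply] using hv
  refine ⟨(q 0 * b 2 - q 1 * a 2) / (P₁ * d), (a 1 * q 1 - b 1 * q 0) / (P₂ * d), ?_⟩
  rw [hw₁, hw₂]
  ext i
  fin_cases i
  · simp [crossSectionMatrix]
    field_simp
    linear_combination -q 0 * hd
  · simp [crossSectionMatrix]
    field_simp
    linear_combination -q 1 * hd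

theorem mainTheorem6
    (L P₁ P₂ : ℝ) (hL : 0 < L) (hP₁ : 0 < P₁) (hP₂ : 0 < P₂)
    (fbar gbar : (Fin 3 → ℝ) → ℝ) (a b : Fin 3 → ℝ)
    (hfbar : ContDiffOn ℝ ∞ fbar (closedLayer L))
    (hgbar : ContDiffOn ℝ ∞ gbar (closedLayer L))
    (ha : ∀ p ∈ closedLayer L, layerGrad L fbar p = a)
    (hb : ∀ p ∈ closedLayer L, layerGrad L gbar p = b)
    (hv : (a ⨯₃ b) 0 ≠ 0)
    (w₁ w₂ : Fin 2 → ℝ)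
    (hw₁ : w₁ = crossSectionMatrix a b *ᵥ ![P₁, 0])
    (hw₂ : w₂ = crossSectionMatrix a b *ᵥ ![0, P₂]) :
    ∃ δ : ℝ, 0 < δ ∧ ∃ η : ℝ, 0 < η ∧
      ∀ (c₁ c₂ : ℝ) (H₀ H : (Fin 2 → ℝ) → ℝ),
        ContDiff ℝ 2 H₀ →
        (∀ q, H₀ (q + w₁) = H₀ q) →
        (∀ q, H₀ (q + w₂) = H₀ q) →
        (∀ q, H q = c₁ * q 0 + c₂ * q 1 + H₀ q) →
        supNormSecondDeriv (closedParallelogram w₁ w₂) H₀ < ENNReal.ofReal η →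
        ∀ f g f' g' : (Fin 3 → ℝ) → ℝ,
          AdmissiblePair L P₁ P₂ f g →
          AdmissiblePair L P₁ P₂ f' g' →
          (∀ p : Fin 3 → ℝ, p 0 = 0 ∨ p 0 = L → f p = f' p ∧ g p = g' p) →
          SolvesEulerLagrange L H f g →
          SolvesEulerLagrange L H f' g' →
          gradC2Dist L P₁ P₂ f g fbar gbar < ENNReal.ofReal δ →
          gradC2Dist L P₁ P₂ f' g' fbar gbar < ENNReal.ofReal δ →
          ∀ p ∈ closedLayer L, f p = f' p ∧ g p = g' p := by
  obtain ⟨M, hM, c, hc, σ, hσ, hctrl⟩ := exists_jet_control hv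
  -- the weight of `x (F² + G²) v`, small enough for `|W|²` to absorb its cross terms
  set κ : ℝ := c / (8 * L ^ 2 * M) with hκ
  have hκ0 : 0 < κ := by positivity
  set ε : ℝ := min (1 / (6 * M)) (κ * c / 32) with hεdef
  have hε : 0 < ε := by positivity
  have hε₁ : 3 * ε * M ≤ 1 / 2 := by
    have : ε * (6 * M) ≤ 1 := (le_div_iff₀ (by positivity)).1 (min_le_left _ _)
    linarith
  have hε₂ : 4 * ε ≤ κ * c / 8 := by
    have : ε ≤ κ * c / 32 := min_le_right _ _
    linarith
  obtain ⟨δ, hδ, hδctrl⟩ := hctrl ε hε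
  refine ⟨δ, hδ, κ * c / 8, by positivity, ?_⟩
  intro c₁ c₂ H₀ H hH₀ hper₁ hper₂ hH hsup f g f' g' hfg hfg' hbd hsol hsol' hdist hdist'
  have hspan := exists_smul_add_smul_eq_of_crossSectionMatrix hP₁.ne' hP₂.ne' hv hw₁ hw₂
  have hbound := norm_iteratedFDeriv_le_of_supNormSecondDeriv_lt hspan hper₁ hper₂
    (by positivity) hsup
  obtain ⟨hf, hg, hfp, hgp⟩ := id hfg
  obtain ⟨hf', hg', hfp', hgp'⟩ := id hfg'
  have hdo : ∀ {φ : (Fin 3 → ℝ) → ℝ}, ContDiffOn ℝ 3 φ (closedLayer L) →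
      DifferentiableOn ℝ φ (closedLayer L) := fun h => h.differentiableOn (by norm_num)
  -- the midpoint of the two pairs
  set m : (Fin 3 → ℝ) → ℝ := fun q => (1 / 2 : ℝ) * (f q + f' q) with hmdef
  set n : (Fin 3 → ℝ) → ℝ := fun q => (1 / 2 : ℝ) * (g q + g' q) with hndef
  have hm : ContDiffOn ℝ 3 m (closedLayer L) := contDiffOn_const.mul (hf.add hf')
  have hn : ContDiffOn ℝ 3 n (closedLayer L) := contDiffOn_const.mul (hg.add hg')
  have hmg : ∀ q ∈ closedLayer L,
      layerGrad L m q = (1 / 2 : ℝ) • (layerGrad L f q + layerGrad L f' q) := fun q hq => by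
    rw [hmdef, layerGrad_const_mul hL hq _ ((hdo hf q hq).fun_add (hdo hf' q hq)),
      layerGrad_add hL hq (hdo hf q hq) (hdo hf' q hq)]
  have hng : ∀ q ∈ closedLayer L,
      layerGrad L n q = (1 / 2 : ℝ) • (layerGrad L g q + layerGrad L g' q) := fun q hq => by
    rw [hndef, layerGrad_const_mul hL hq _ ((hdo hg q hq).fun_add (hdo hg' q hq)),
      layerGrad_add hL hq (hdo hg q hq) (hdo hg' q hq)]
  set u := gradPair L m n with hudef
  have hu : ContDiffOn ℝ 2 u (closedLayer L) := contDiffOn_gradPair hL hm hn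
  have hmid : EqOn u (fun q => (1 / 2 : ℝ) • (gradPair L f g q + gradPair L f' g' q))
      (closedLayer L) := fun q hq => Prod.ext (hmg q hq) (hng q hq)
  have hjet : ∀ p ∈ closedCell L P₁ P₂, ‖layerJet L u p - ((a, b), 0)‖ < δ ∧
      ‖fderivWithin ℝ (layerJet L u) (closedLayer L) p‖ < δ := fun p hp =>
    layerJet_bounds_midpoint hL hmid (contDiffOn_gradPair hL hf hg) (contDiffOn_gradPair hL hf' hg')
      (closedCell_subset_closedLayer L P₁ P₂ hp)
      (layerJet_bounds_of_gradC2Dist_lt hL hf hg ha hb hdist hp)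
      (layerJet_bounds_of_gradC2Dist_lt hL hf' hg' ha hb hdist' hp)
  have hTper : LayerPeriodic L P₁ P₂ (layerJet L u) :=
    ((((hfp.prodMk hgp).prodMk (hfp'.prodMk hgp')).comp
      fun w => (1 / 2 : ℝ) • (w.1 + w.2)).of_eqOn hmid).layerJet
  have hvv : ∀ p ∈ closedLayer L,
      jetVelocity (layerJet L u p) ⬝ᵥ jetVelocity (layerJet L u p) ≠ 0 := by
    intro p hp
    obtain ⟨q, hq, hqp⟩ := hTper.exists_mem_closedCell hP₁ hP₂ hp
    have h := (hδctrl _ (hjet q hq).1).1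
    rw [hqp] at h
    rw [Ne, dotProduct_self_eq_zero]
    intro h0
    rw [h0, Pi.zero_apply, mul_zero] at h
    linarith
  -- the difference of the two pairs
  set F : (Fin 3 → ℝ) → ℝ := fun q => f q - f' q with hFdef
  set G : (Fin 3 → ℝ) → ℝ := fun q => g q - g' q with hGdef
  have hF : ContDiffOn ℝ 3 F (closedLayer L) := hf.sub hf'
  have hG : ContDiffOn ℝ 3 G (closedLayer L) := hg.sub hg'
  have hFg : ∀ q ∈ closedLayer L, layerGrad L F q = layerGrad L f q - layerGrad L f' q :=
    fun q hq => layerGrad_sub hL hq (hdo hf q hq) (hdo hf' q hq)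
  have hGg : ∀ q ∈ closedLayer L, layerGrad L G q = layerGrad L g q - layerGrad L g' q :=
    fun q hq => layerGrad_sub hL hq (hdo hg q hq) (hdo hg' q hq)
  have hF0 : ∀ p : Fin 3 → ℝ, p 0 = 0 ∨ p 0 = L → F p = 0 := fun p hp => sub_eq_zero.2 (hbd p hp).1
  have hG0 : ∀ p : Fin 3 → ℝ, p 0 = 0 ∨ p 0 = L → G p = 0 := fun p hp => sub_eq_zero.2 (hbd p hp).2
  have hFgper : LayerPeriodic L P₁ P₂ (layerGrad L F) :=
    ((hfp.prodMk hfp').comp fun w => w.1 - w.2).of_eqOn hFg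
  have hGgper : LayerPeriodic L P₁ P₂ (layerGrad L G) :=
    ((hgp.prodMk hgp').comp fun w => w.1 - w.2).of_eqOn hGg
  have hFper := periodic_of_layerGrad_periodic hL (hdo hF) hFgper fun p hp => hF0 p (Or.inl hp)
  have hGper := periodic_of_layerGrad_periodic hL (hdo hG) hGgper fun p hp => hG0 p (Or.inl hp)
  set E : (Fin 3 → ℝ) → GradPair :=
    fun q => eulerLagrangeFlux L f g q - eulerLagrangeFlux L f' g' q with hEdef
  have hE : ContDiffOn ℝ 1 E (closedLayer L) :=
    (contDiffOn_eulerLagrangeFlux hL hf hg).sub (contDiffOn_eulerLagrangeFlux hL hf' hg')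
  have hEper : LayerPeriodic L P₁ P₂ E :=
    (hfg.periodic_eulerLagrangeFlux.prodMk hfg'.periodic_eulerLagrangeFlux).comp
      fun w => w.1 - w.2
  set Z := coercivityField L (κ * σ) u F G (fun q => (E q).1) (fun q => (E q).2) with hZdef
  have hle2 : ∀ {φ : (Fin 3 → ℝ) → ℝ}, ContDiffOn ℝ 3 φ (closedLayer L) →
      ContDiffOn ℝ 2 φ (closedLayer L) := fun h => h.of_le (by norm_num)
  have hZ : ContDiffOn ℝ 1 Z (closedLayer L) :=
    contDiffOn_coercivityField hL _ hu hvv (hle2 hF) (hle2 hG) hE.fst hE.snd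
  have hZper : LayerPeriodic L P₁ P₂ Z :=
    periodic_coercivityField _ hTper hFper hGper hGgper (hEper.comp Prod.fst) (hEper.comp Prod.snd)
  have hZ0 : ∀ p, p 0 = 0 ∨ p 0 = L → Z p = 0 := fun p hp => by
    simp [hZdef, coercivityField, hF0 p hp, hG0 p hp]
  -- only interior points are needed, where the Euler–Lagrange equations hold
  have hcoer : ∀ p ∈ closedCell L P₁ P₂, p ∈ openLayer L →
      κ * c / 4 * (F p ^ 2 + G p ^ 2) ≤ layerDiv L Z p := by
    intro p hp hpo
    have hpl := closedCell_subset_closedLayer L P₁ P₂ hp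
    have hTd := (contDiffOn_layerJet hL hu).differentiableOn (by norm_num) p hpl
    obtain ⟨hT, hDT⟩ := hjet p hp
    obtain ⟨k₀, kA, kB, kv, kV', kA', kB', kD⟩ := hδctrl _ hT
    obtain ⟨kD₁, kD₂, kD₃⟩ := kD _ hDT
    have dA := (contDiffAt_jetCoeffA (n := 1) (hvv p hpl)).differentiableAt (by norm_num)
    have dB := (contDiffAt_jetCoeffB (n := 1) (hvv p hpl)).differentiableAt (by norm_num)
    have dFA : DifferentiableAt ℝ jetFrameA (layerJet L u p) :=
      (contDiffAt_jetFrameA (n := 1)).differentiableAt (by norm_num)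
    have dFB : DifferentiableAt ℝ jetFrameB (layerJet L u p) :=
      (contDiffAt_jetFrameB (n := 1)).differentiableAt (by norm_num)
    rw [← layerDiv_comp hL hpl (dB.fun_smul dFA) hTd] at kD₁
    rw [← layerDiv_comp hL hpl (dA.fun_smul dFA) hTd] at kD₂
    rw [← layerDiv_comp hL hpl (dA.fun_smul dFB) hTd] at kD₃
    rw [hZdef, layerDiv_coercivityField hL hpl (κ * σ)
      (hu.differentiableOn (by norm_num) p hpl) hTd (hvv p hpl)
      (layerDiv_jetVelocity_gradPair hL (hle2 hm) (hle2 hn) hpl) (hdo hF p hpl) (hle2 hG)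
      (hE.fst.differentiableOn (by norm_num) p hpl) (hE.snd.differentiableOn (by norm_num) p hpl)
      rfl rfl rfl rfl rfl rfl rfl]
    have hHam := hsol.flux_difference_ge hL hH₀ hH hbound hf hg hf' hg' hsol' hpo
    set φ := layerGrad L F p with hφ
    set γ := layerGrad L G p with hγ
    set A := layerGrad L m p with hA
    set B := layerGrad L n p with hB
    have hflux := flux_difference_identity A B φ γ (layerGrad L f p) (layerGrad L g p)
      (layerGrad L f' p) (layerGrad L g' p) (by rw [hA, hφ, hmg p hpl, hFg p hpl]; module)
      (by rw [hB, hγ, hng p hpl, hGg p hpl]; module)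
      (by rw [hA, hφ, hmg p hpl, hFg p hpl]; module)
      (by rw [hB, hγ, hng p hpl, hGg p hpl]; module)
    -- `v = A × B` is the velocity of the jet of `u` at `p` by definition
    change φ ⬝ᵥ (E p).1 + γ ⬝ᵥ (E p).2
      = _ + 2 * (φ ⬝ᵥ γ ⨯₃ jetVelocity (layerJet L u p)) + _ at hflux
    obtain ⟨lα, lβ, lS⟩ := linearized_velocity_controls A B φ γ
    have hN := dotProduct_self_nonneg_three (φ ⨯₃ B + A ⨯₃ γ)
    have hX := dotProduct_self_nonneg_three (φ ⨯₃ γ)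
    have key := coercivity_estimate (F := F p) (G := G p)
      (α := jetVelocity (layerJet L u p) ⬝ᵥ φ) (β := jetVelocity (layerJet L u p) ⬝ᵥ γ)
      (S := jetFrameA (layerJet L u p) ⬝ᵥ φ + jetFrameB (layerJet L u p) ⬝ᵥ γ)
      (h := F p * layerDiv L (fun q => (E q).1) p + G p * layerDiv L (fun q => (E q).2) p)
      hL hM hc hκ hε₁ hε₂ hN
      (lα.trans (mul_le_mul_of_nonneg_right kA hN)) (lβ.trans (mul_le_mul_of_nonneg_right kB hN))
      (lS.trans (mul_le_mul_of_nonneg_right kv hN)) kV' kA' kB' kD₁ kD₂ kD₃ hpl.1 hpl.2 hσ k₀ hHam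
    linarith
  have hzero : ∀ p ∈ closedCell L P₁ P₂, F p ^ 2 + G p ^ 2 = 0 := by
    intro p hp
    have h := eq_zero_of_le_layerDiv hL hP₁ hP₂ hZ hZper hZ0
      (φ := fun q => κ * c / 4 * (F q ^ 2 + G q ^ 2))
      (continuousOn_const.mul ((hF.continuousOn.pow 2).add (hG.continuousOn.pow 2)))
      (fun q => by positivity) hcoer hp
    exact (mul_eq_zero.1 h).resolve_left (by positivity)
  intro p hp
  obtain ⟨q, hq, hqp⟩ := (hFper.prodMk hGper).exists_mem_closedCell hP₁ hP₂ hp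
  obtain ⟨hqF, hqG⟩ := Prod.ext_iff.1 hqp
  have hz := hzero q hq
  simp only at hqF hqG
  rw [hqF, hqG] at hz
  have hFp : F p = 0 := by nlinarith [sq_nonneg (F p), sq_nonneg (G p)]
  have hGp : G p = 0 := by nlinarith [sq_nonneg (F p), sq_nonneg (G p)]
  exact ⟨sub_eq_zero.1 hFp, sub_eq_zero.1 hGp⟩
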